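/- Let $\log$ be the logarithm to an arbitrary fixed base larger than $1$. For $\alpha>0$ and a probability mass function (pmf) $P$ on a finite set let $H_\alpha(P)=\frac1{1-\alpha}\log\sum_x P(x)^\alpha$ if $\alpha\ne1$, and $H_1(P)=-\sum_x P(x)\log P(x)$ (with $0\log 0=0$); for a random variable $X$ with pmf $P_X$ put $H_\alpha(X)=H_\alpha(P_X)$. For integers $k\ge2$ let $c_\alpha^{(k)}(2)=\log k-\min_P H_\alpha(P)$, where the minimum is over all pmfs $P$ on $\{1,\dots,k\}$ with positive masses such that $\max_i P(i)\le 2\min_i P(i)$, and let $$v(\alpha)=\begin{cases}\log\left(\frac{\alpha-1}{2^\alpha-2}\right)-\frac{\alpha}{\alpha-1}\log\left(\frac{\alpha}{2^\alpha-1}\right), & \alpha\neq1,\\ \log\left(\frac{2}{e\ln 2}\right), & \alpha=1.\end{cases}$$ Then $v(\alpha)=c_\alpha^{(\infty)}(2):=\lim_{k\to\infty}c_\alpha^{(k)}(2)$ for every $\alpha>0$, and $v(1)\approx 0.08607$ for base $2$. Let $n>m\ge2$ be integers and let $X$ be a random variable with values in $\{1,\dots,n\}$ such that $P_X(1)\ge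 P_X(2)\ge\dots\ge P_X(n)$. Let $\mathcal F_{n,m}$ be the set of functions from $\{1,\dots,n\}$ onto $\{1,\dots,m\}$. (a) If $P_X(1)<\frac1m$, let $\widetilde X_m$ be equiprobable on $\{1,\dots,m\}$; otherwise let $\widetilde X_m$ have the pmf $$P_{\widetilde X_m}(i)=\begin{cases}P_X(i), & 1\le i\le n^*,\\ \frac1{m-n^*}\sum_{j=n^*+1}^n P_X(j), & n^*<i\le m,\end{cases}$$ where $n^*$ is the maximal $i\in\{1,\dots,m-1\}$ such that $P_X(i)\ge\frac1{m-i}\sum_{j=i+1}^nP_X(j)$. Then for every $\alpha>0$ $$\max_{f\in\mathcal F_{n,m}}H_\alpha(f(X))\in\bigl[H_\alpha(\widetilde X_m)-v(\alpha),\,H_\alpha(\widetilde X_m)\bigr],$$ and the same holds for the maximum over all functions $f:\{1,\dots,n\}\to\{1,\dots,m\}$. (b) Start from the masses $P_X(1),\dots,P_X(n)$ and successively merge two smallest masses (Huffman algorithm), with ties broken arbitrarily, until $m$ masses $Q(1)\ge\dots\ge Q(m)$ remain; let $f^*(k)=j$ if $P_X(k)$ has been merged into $Q(j)$. Such an $f^*\in\mathcal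 F_{n,m}$ exists, it does not depend on $\alpha$, and every $f^*$ so obtained satisfies, for all $\alpha>0$, $$H_\alpha(f^*(X))\in\bigl[H_\alpha(\widetilde X_m)-v(\alpha),\,H_\alpha(\widetilde X_m)\bigr].$$ (c) Let $\widetilde Y_m$ have the pmf $P_{\widetilde Y_m}(1)=\sum_{k=1}^{n-m+1}P_X(k)$ and $P_{\widetilde Y_m}(i)=P_X(n-m+i)$ for $2\le i\le m$. Then for every $\alpha>0$ $$\min_{f\in\mathcal F_{n,m}}H_\alpha(f(X))=H_\alpha(\widetilde Y_m).$$ -/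

import Mathlib

open Filter Topology MeasureTheory

noncomputable section

namespace RenyiMerging

/-- The probability mass function of a random variable `X` with values in a finite type:
`P_X(i) = μ(X = i)`. -/
def pmfOf {Ω ι : Type*} [MeasurableSpace Ω] (μ : Measure Ω) (X : Ω → ι) (i : ι) : ℝ :=
  μ.real (X ⁻¹' {i})

/-- The Rényi entropy, with logarithms to the base `b`, of order `α ∈ (0, ∞)` of a probability
mass function `P` on a finite type; order `1` is the Shannon entropy. -/
def renyiEntropy {ι : Type*} [Fintype ι] (b α : ℝ) (P : ι → ℝ) : ℝ :=
  if α = 1 then -∑ i, P i * Real.logb b (P i)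
  else 1 / (1 - α) * Real.logb b (∑ i, P i ^ α)

/-- The probability mass functions on `n` points whose ratio of the maximal to the minimal mass is
at most `ρ`. The inequalities force every mass to be positive. -/
def boundedRatio (n : ℕ) (ρ : ℝ) : Set (Fin n → ℝ) :=
  {P | P ∈ stdSimplex ℝ (Fin n) ∧ ∀ i j, P i ≤ ρ * P j}

/-- `c_α^{(n)}(ρ)`: the logarithm of `n` minus the minimum of the order-`α` Rényi entropy over
`boundedRatio n ρ`. -/
def renyiGap (b α : ℝ) (n : ℕ) (ρ : ℝ) : ℝ :=
  Real.logb b n - sInf (renyiEntropy b α '' boundedRatio n ρ)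

/-- The closed form of `v(α)`. -/
def v (b α : ℝ) : ℝ :=
  if α = 1 then Real.logb b (2 / (Real.exp 1 * Real.log 2))
  else Real.logb b ((α - 1) / ((2 : ℝ) ^ α - 2))
    - α / (α - 1) * Real.logb b (α / ((2 : ℝ) ^ α - 1))

/-- The `i`-th mass `P(i)`, for `i ∈ {1, …, n}`: the points of `{1, …, n}` are
the elements `0, …, n - 1` of `Fin n`, shifted by one. -/
def mass {n : ℕ} (P : Fin n → ℝ) (i : ℕ) : ℝ :=
  if h : 1 ≤ i ∧ i ≤ n then P ⟨i - 1, by omega⟩ else 0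

open Classical in
/-- `n*`: the maximal `i ∈ {1, …, m - 1}` such that
`P(i) ≥ (P(i + 1) + ⋯ + P(n)) / (m - i)` (there is one if `P(1) ≥ 1 / m`). -/
def nStar {n : ℕ} (P : Fin n → ℝ) (m : ℕ) : ℕ :=
  Nat.findGreatest
    (fun i => 1 ≤ i ∧ 1 / ((m : ℝ) - i) * ∑ j ∈ Finset.Icc (i + 1) n, mass P j ≤ mass P i) (m - 1)

open Classical in
/-- The probability mass function of `X̃_m`. -/
def xTilde {n : ℕ} (P : Fin n → ℝ) (m : ℕ) (i : Fin m) : ℝ :=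
  if mass P 1 < 1 / (m : ℝ) then 1 / (m : ℝ)
  else if (i : ℕ) + 1 ≤ nStar P m then mass P (i + 1)
  else 1 / ((m : ℝ) - nStar P m) * ∑ j ∈ Finset.Icc (nStar P m + 1) n, mass P j

/-- The probability mass function of `Ỹ_m` (for `m ≤ n`). -/
def yTilde {n : ℕ} (P : Fin n → ℝ) (m : ℕ) (i : Fin m) : ℝ :=
  if (i : ℕ) + 1 = 1 then ∑ k ∈ Finset.Icc 1 (n - m + 1), mass P k
  else mass P (n - m + (i + 1))

/-- The partitions of `{1, …, n}` that the Huffman algorithm can reach from the partition into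
singletons (the original masses), by repeatedly merging two blocks of smallest total mass:
`A` has the smallest mass, `B` has the smallest mass among the other blocks; ties are broken
arbitrarily. -/
inductive HuffmanReachable {n : ℕ} (P : Fin n → ℝ) : Finset (Finset (Fin n)) → Prop
  | start : HuffmanReachable P (Finset.univ.image fun k => {k})
  | merge (S : Finset (Finset (Fin n))) (A B : Finset (Fin n)) (hS : HuffmanReachable P S)
      (hA : A ∈ S) (hB : B ∈ S) (hAB : A ≠ B)
      (hminA : ∀ C ∈ S, ∑ k ∈ A, P k ≤ ∑ k ∈ C, P k)
      (hminB : ∀ C ∈ S, C ≠ A → ∑ k ∈ B, P k ≤ ∑ k ∈ C, P k) :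
      HuffmanReachable P (insert (A ∪ B) ((S.erase A).erase B))

/-- `f : {1, …, n} → {1, …, m}` is a Huffman map for `P`: its fibres are the `m` blocks that the
Huffman algorithm has produced when it is stopped at `m` masses, numbered such that the merged
masses satisfy `Q(1) ≥ ⋯ ≥ Q(m)`. -/
def IsHuffmanMap {n m : ℕ} (P : Fin n → ℝ) (f : Fin n → Fin m) : Prop :=
  ∃ S : Finset (Finset (Fin n)), HuffmanReachable P S ∧ S.card = m ∧
    S = Finset.univ.image (fun j : Fin m => Finset.univ.filter fun k => f k = j) ∧
    Antitone fun j : Fin m => ∑ k ∈ Finset.univ.filter (fun k => f k = j), P k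

end RenyiMerging

end

namespace RenyiMerging

/-! Everything is a comparison of sums ∑ φ (P i) with φ convex on [0, ∞). The entropy of order α is
a monotone function of such a sum, with φ = x ^ α, -x ^ α or x log x according as α > 1, α < 1 or α
= 1. An inequality valid for every convex φ therefore settles all orders at once
(`renyiEntropy_le_of_convex_sum_le`).

X̃_m has the smallest convex sums among all mergings (`convexOn_sum_le_sum_push`). Subtract from φ
its supporting line at the level c of the equalised masses. The remainder is nonnegative, vanishes
at c, and is increasing and superadditive on [c, ∞), so each block contributes at least as much as
the kept masses inside it; the affine terms balance since the totals agree. Dually, Ỹ_m has the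
largest convex sums among onto mergings (`sum_push_le_sum_yTilde`): it arises by moving the excess
of the other blocks into the block of the largest original mass.

For the lower bound, merging two smallest blocks gives a block with at most twice the mass of any
other (`HuffmanReachable.invariant`). If p is the smallest final mass, blocks heavier than 2p are
thus original masses, and X̃_m keeps these too; all other blocks lie in [p, 2p]
(`IsHuffmanMap.exists_levels`). On those, the chord of φ over [p, 2p] bounds the sum in terms of the
mean alone, and comparing chord and graph at the mean costs exactly v(α) (`rpow_chord_le`,
`le_rpow_chord`, `mul_log_chord_le`, `renyiEntropy_sub_v_le`).

The same estimate against the uniform distribution gives c_α^{(k)}(2) ≤ v(α). Mass functions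
supported on the two ends of the chord, with the mean at the worst point, attain v(α) in the limit
(`tendsto_renyiGap`). -/

/-- The masses that a map `f` collects from the masses `P`. -/
def push {n m : ℕ} (P : Fin n → ℝ) (f : Fin n → Fin m) (j : Fin m) : ℝ :=
  ∑ k ∈ Finset.univ.filter (fun k => f k = j), P k

lemma sum_push {n m : ℕ} (P : Fin n → ℝ) (f : Fin n → Fin m) :
    ∑ j, push P f j = ∑ k, P k :=
  Finset.sum_fiberwise _ _ _

lemma push_nonneg {n m : ℕ} {P : Fin n → ℝ} (hP : ∀ k, 0 ≤ P k) (f : Fin n → Fin m) (j : Fin m) :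
    0 ≤ push P f j :=
  Finset.sum_nonneg fun k _ => hP k

lemma le_push {n m : ℕ} {P : Fin n → ℝ} (hP : ∀ k, 0 ≤ P k) (f : Fin n → Fin m) (k : Fin n) :
    P k ≤ push P f (f k) :=
  Finset.single_le_sum (f := P) (fun k _ => hP k) (by simp)

/-! ### Convex functions on the half-line -/

/-- The increments of a convex function are monotone. -/
lemma convexOn_increment_le {φ : ℝ → ℝ} (hφ : ConvexOn ℝ (Set.Ici 0) φ) {x y d : ℝ}
    (hx : 0 ≤ x) (hxy : x ≤ y) (hd : 0 ≤ d) : φ (x + d) - φ x ≤ φ (y + d) - φ y := by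
  rcases hd.eq_or_lt with rfl | hd
  · simp
  have hL : 0 < y + d - x := by linarith
  have hmx : x ∈ Set.Ici (0 : ℝ) := hx
  have hmy : y + d ∈ Set.Ici (0 : ℝ) := by simp only [Set.mem_Ici]; linarith
  have hw : 0 ≤ d / (y + d - x) := by positivity
  have hw' : 0 ≤ (y - x) / (y + d - x) := div_nonneg (by linarith) hL.le
  have hsum : (y - x) / (y + d - x) + d / (y + d - x) = 1 := by field_simp; ring
  -- Both x + d and y are convex combinations of x and y + d, with the two weights interchanged;
  -- adding the two convexity inequalities gives the claim.
  have h1 := hφ.2 hmx hmy hw' hw hsum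
  have h2 := hφ.2 hmx hmy hw hw' (by rw [add_comm]; exact hsum)
  simp only [smul_eq_mul] at h1 h2
  have e1 : (y - x) / (y + d - x) * x + d / (y + d - x) * (y + d) = x + d := by
    field_simp; ring
  have e2 : d / (y + d - x) * x + (y - x) / (y + d - x) * (y + d) = y := by
    field_simp; ring
  rw [e1] at h1
  rw [e2] at h2
  have e3 : (y - x) / (y + d - x) = 1 - d / (y + d - x) := by linarith
  rw [e3] at h1 h2
  nlinarith

/-- Collecting increments at the largest argument increases a convex sum. -/
lemma convexOn_sum_increment_le {φ : ℝ → ℝ} (hφ : ConvexOn ℝ (Set.Ici 0) φ) {ι : Type*}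
    (s : Finset ι) (y d : ι → ℝ) {T : ℝ} (hy : ∀ i ∈ s, 0 ≤ y i) (hyT : ∀ i ∈ s, y i ≤ T)
    (hd : ∀ i ∈ s, 0 ≤ d i) :
    ∑ i ∈ s, (φ (y i + d i) - φ (y i)) ≤ φ (T + ∑ i ∈ s, d i) - φ T := by
  classical
  induction s using Finset.induction_on with
  | empty => simp
  | insert a s ha ih =>
    rw [Finset.sum_insert ha, Finset.sum_insert ha]
    have h1 := ih (fun i hi => hy i (by simp [hi])) (fun i hi => hyT i (by simp [hi]))
      (fun i hi => hd i (by simp [hi]))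
    have hs : 0 ≤ ∑ i ∈ s, d i := Finset.sum_nonneg fun i hi => hd i (by simp [hi])
    have h2 := convexOn_increment_le hφ (x := y a) (y := T + ∑ i ∈ s, d i) (d := d a)
      (hy a (by simp)) (by linarith [hyT a (by simp)]) (hd a (by simp))
    have e : T + (d a + ∑ i ∈ s, d i) = T + ∑ i ∈ s, d i + d a := by ring
    rw [e]
    linarith

/-- A convex function on `[0, ∞)` has a supporting line at each positive point. -/
lemma convexOn_exists_supporting_line {φ : ℝ → ℝ} (hφ : ConvexOn ℝ (Set.Ici 0) φ) {c : ℝ}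
    (hc : 0 < c) : ∃ a : ℝ, ∀ x, 0 ≤ x → φ c + a * (x - c) ≤ φ x := by
  have hci : c ∈ interior (Set.Ici (0 : ℝ)) := by simpa using hc
  refine ⟨derivWithin φ (Set.Ioi c) c, fun x hx => ?_⟩
  rcases lt_trichotomy x c with h | h | h
  · have h1 := hφ.slope_le_leftDeriv_of_mem_interior hx hci h
    have h2 := hφ.leftDeriv_le_rightDeriv_of_mem_interior hci
    have h3 := h1.trans h2
    rw [slope_def_field, div_le_iff₀ (by linarith)] at h3
    linarith
  · subst h; simp
  · have h1 := hφ.rightDeriv_le_slope_of_mem_interior hci hx h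
    rw [slope_def_field, le_div_iff₀ (by linarith)] at h1
    linarith

/-- A convex function that vanishes at `c` and does not decrease from `b` to `b + c` is
superadditive on `[c, ∞)`. -/
lemma convexOn_sum_le_apply_sum {ψ : ℝ → ℝ} (hψ : ConvexOn ℝ (Set.Ici 0) ψ) {c : ℝ} (hc : 0 ≤ c)
    (hψc : ψ c = 0) (hmono : ∀ b, c ≤ b → ψ b ≤ ψ (b + c)) {ι : Type*} {s : Finset ι}
    (hs : s.Nonempty) (a : ι → ℝ) (ha : ∀ i ∈ s, c ≤ a i) :
    ∑ i ∈ s, ψ (a i) ≤ ψ (∑ i ∈ s, a i) := by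
  induction hs using Finset.Nonempty.cons_induction with
  | singleton i => simp
  | cons i s hi hs ih =>
    rw [Finset.sum_cons, Finset.sum_cons]
    have h1 := ih fun j hj => ha j (by simp [hj])
    have hi' := ha i (by simp)
    have hS : c ≤ ∑ j ∈ s, a j := by
      obtain ⟨j, hj⟩ := hs
      exact (ha j (by simp [hj])).trans
        (Finset.single_le_sum (f := a) (fun l hl => hc.trans (ha l (by simp [hl]))) hj)
    -- With S the sum over `s`, the increment over S is at least as large from `a i` as from c. As ψ
    -- c = 0, this reads ψ (c + S) + ψ (a i) ≤ ψ (a i + S), and `hmono` replaces ψ (c + S) by ψ S.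
    have h2 := convexOn_increment_le hψ hc hi' (hc.trans hS)
    have h3 := hmono _ hS
    rw [add_comm (∑ j ∈ s, a j) c] at h3
    linarith

/-! ### Extremality of X̃_m -/

/-- Among the mass functions obtained by merging, none is less spread out than the one that keeps
the first `k` masses and replaces the others by equal masses. -/
lemma convexOn_sum_le_sum_push {φ : ℝ → ℝ} (hφ : ConvexOn ℝ (Set.Ici 0) φ) {n m : ℕ}
    {P : Fin n → ℝ} (hP : ∀ k, 0 ≤ P k) (f : Fin n → Fin m) {k : ℕ} {c : ℝ}
    (hc : 0 ≤ c) (hcP : ∀ i : Fin n, (i : ℕ) < k → c ≤ P i)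
    (hsum : ((m : ℝ) - k) * c = ∑ i ∈ Finset.univ.filter (fun i : Fin n => k ≤ (i : ℕ)), P i)
    (hkn : k ≤ n) :
    ∑ i ∈ Finset.univ.filter (fun i : Fin n => (i : ℕ) < k), φ (P i) + ((m : ℝ) - k) * φ c
      ≤ ∑ j, φ (push P f j) := by
  classical
  obtain ⟨a, hlow⟩ : ∃ a : ℝ, ∀ j : Fin m,
      ∑ i ∈ Finset.univ.filter (fun i : Fin n => f i = j ∧ (i : ℕ) < k),
        (φ (P i) - φ c - a * (P i - c)) ≤ φ (push P f j) - φ c - a * (push P f j - c) := by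
    -- At c = 0 a supporting line may fail to exist (as for x log x). But then all masses from index
    -- k on vanish, and slope 0 works by superadditivity.
    rcases hc.eq_or_lt with rfl | hc0
    · refine ⟨0, fun j => ?_⟩
      have hz : ∀ i : Fin n, k ≤ (i : ℕ) → P i = 0 := by
        intro i hi
        rw [mul_zero, eq_comm, Finset.sum_eq_zero_iff_of_nonneg (fun i _ => hP i)] at hsum
        exact hsum i (by simp [hi])
      have hQ : push P f j =
          ∑ i ∈ Finset.univ.filter (fun i : Fin n => f i = j ∧ (i : ℕ) < k), P i := by
        rw [push]
        symm
        apply Finset.sum_subset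
        · intro i; simp; tauto
        · intro i hi hi'
          apply hz
          simp at hi hi'
          exact hi' hi
      rw [hQ]
      rcases Finset.eq_empty_or_nonempty
        (Finset.univ.filter (fun i : Fin n => f i = j ∧ (i : ℕ) < k)) with h | h
      · rw [h]; simp
      · have := convexOn_sum_le_apply_sum (ψ := fun x => φ x - φ 0)
          ((hφ.add_const (-φ 0)).congr fun x _ => (sub_eq_add_neg _ _).symm) le_rfl
          (by simp) (by simp) h P (fun i _ => hP i)
        simpa using this
    · obtain ⟨a, ha⟩ := convexOn_exists_supporting_line hφ hc0
      refine ⟨a, fun j => ?_⟩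
      have hψ : ConvexOn ℝ (Set.Ici 0) (fun x => φ x - φ c - a * (x - c)) := by
        refine ⟨hφ.1, fun x hx y hy s t hs ht hst => ?_⟩
        have h1 := hφ.2 hx hy hs ht hst
        simp only [smul_eq_mul] at h1 ⊢
        obtain rfl : s = 1 - t := by linarith
        linarith
      have hψ0 : ∀ x, 0 ≤ x → 0 ≤ φ x - φ c - a * (x - c) := fun x hx => by linarith [ha x hx]
      -- The increment from x to y is at least the one of the same length starting at c, where the
      -- function attains its minimum 0.
      have hmono : ∀ x y, c ≤ x → x ≤ y →
          φ x - φ c - a * (x - c) ≤ φ y - φ c - a * (y - c) := by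
        intro x y hx hxy
        have h1 := convexOn_increment_le hψ hc0.le hx (sub_nonneg.2 hxy)
        have h2 := hψ0 (c + (y - x)) (by linarith)
        simp only [sub_self, mul_zero, sub_zero, add_sub_cancel] at h1
        linarith
      rcases Finset.eq_empty_or_nonempty
        (Finset.univ.filter (fun i : Fin n => f i = j ∧ (i : ℕ) < k)) with h | h
      · rw [h]; simpa using hψ0 _ (push_nonneg hP f j)
      · have hle := convexOn_sum_le_apply_sum hψ hc (by simp)
          (fun b hb => hmono b (b + c) hb (by linarith)) h P
          (fun i hi => hcP i (by simp at hi; exact hi.2))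
        refine hle.trans (hmono _ _ ?_ ?_)
        · obtain ⟨i, hi⟩ := h
          exact (hcP i (by simp at hi; exact hi.2)).trans
            (Finset.single_le_sum (f := P) (fun l _ => hP l) hi)
        · exact Finset.sum_le_sum_of_subset_of_nonneg (by intro i; simp; tauto)
            (fun i _ _ => hP i)
  have htot := Finset.sum_le_sum fun j (_ : j ∈ Finset.univ) => hlow j
  have hfib : ∀ g : Fin n → ℝ,
      ∑ j, ∑ i ∈ Finset.univ.filter (fun i : Fin n => f i = j ∧ (i : ℕ) < k), g i =
        ∑ i ∈ Finset.univ.filter (fun i : Fin n => (i : ℕ) < k), g i := by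
    intro g
    rw [← Finset.sum_fiberwise _ f g]
    refine Finset.sum_congr rfl fun j _ => Finset.sum_congr ?_ fun _ _ => rfl
    ext i; simp [and_comm]
  rw [hfib] at htot
  have hcard : (Finset.univ.filter (fun i : Fin n => (i : ℕ) < k)).card = k := by
    rw [Fin.card_filter_val_lt]; omega
  -- This makes the terms with slope `a` cancel on the two sides of `htot`.
  have hsplit : ∑ i ∈ Finset.univ.filter (fun i : Fin n => (i : ℕ) < k), P i
      + ((m : ℝ) - k) * c = ∑ j, push P f j := by
    rw [hsum, sum_push, ← Finset.sum_filter_add_sum_filter_not Finset.univ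
      (fun i : Fin n => (i : ℕ) < k)]
    simp
  simp only [Finset.sum_sub_distrib, ← Finset.mul_sum, Finset.sum_const, hcard,
    Finset.card_univ, Fintype.card_fin, nsmul_eq_mul] at htot
  rw [← hsplit] at htot
  linarith

lemma mass_add_one {n : ℕ} (P : Fin n → ℝ) {i : ℕ} (hi : i < n) : mass P (i + 1) = P ⟨i, hi⟩ := by
  simp [mass, hi]

lemma sum_mass_Icc {n : ℕ} (P : Fin n → ℝ) (k : ℕ) :
    ∑ j ∈ Finset.Icc (k + 1) n, mass P j =
      ∑ i ∈ Finset.univ.filter (fun i : Fin n => k ≤ (i : ℕ)), P i := by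
  symm
  refine Finset.sum_bij (fun i _ => (i : ℕ) + 1) ?_ ?_ ?_ ?_
  · intro i hi
    simp at hi ⊢
    omega
  · intro i _ j _ h
    exact Fin.ext (by omega)
  · intro j hj
    simp at hj
    exact ⟨⟨j - 1, by omega⟩, by simp; omega, by simp; omega⟩
  · intro i _
    rw [mass_add_one P i.2]

lemma sum_mass_Icc_one {n : ℕ} (P : Fin n → ℝ) {l : ℕ} (hl : l ≤ n) :
    ∑ j ∈ Finset.Icc 1 l, mass P j =
      ∑ i ∈ Finset.univ.filter (fun i : Fin n => (i : ℕ) < l), P i := by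
  symm
  refine Finset.sum_bij (fun i _ => (i : ℕ) + 1) ?_ ?_ ?_ ?_
  · intro i hi
    simp at hi ⊢
    omega
  · intro i _ j _ h
    exact Fin.ext (by omega)
  · intro j hj
    simp at hj
    exact ⟨⟨j - 1, by omega⟩, by simp; omega, by simp; omega⟩
  · intro i _
    rw [mass_add_one P i.2]

/-- The explicit form of `X̃_m`: it keeps the first `k` masses and levels the others, where `k`
is an upper bound for all indices at which the mass dominates the average of its successors. -/
lemma xTilde_spec {n m : ℕ} {P : Fin n → ℝ} (hP : ∀ k, 0 ≤ P k) (hP1 : ∑ k, P k = 1)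
    (hanti : Antitone P) (hm : 2 ≤ m) (hmn : m < n) :
    ∃ (k : ℕ) (c : ℝ), k < m ∧ 0 ≤ c ∧
      (∀ i : Fin m, xTilde P m i = if (i : ℕ) < k then P ⟨i, i.2.trans hmn⟩ else c) ∧
      ((m : ℝ) - k) * c = ∑ i ∈ Finset.univ.filter (fun i : Fin n => k ≤ (i : ℕ)), P i ∧
      (∀ i : Fin n, (i : ℕ) < k → c ≤ P i) ∧
      ∀ (l : ℕ) (hl : l + 1 < m),
        ∑ i ∈ Finset.univ.filter (fun i : Fin n => l + 1 ≤ (i : ℕ)), P i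
          ≤ ((m : ℝ) - (l + 1)) * P ⟨l, by omega⟩ → l + 1 ≤ k := by
  classical
  have hm0 : (0 : ℝ) < m := by exact_mod_cast (by omega : 0 < m)
  have hsplit : ∀ l : ℕ, ∑ i ∈ Finset.univ.filter (fun i : Fin n => (i : ℕ) < l), P i +
      ∑ i ∈ Finset.univ.filter (fun i : Fin n => l ≤ (i : ℕ)), P i = 1 := by
    intro l
    rw [← hP1, ← Finset.sum_filter_add_sum_filter_not Finset.univ (fun i : Fin n => (i : ℕ) < l)]
    simp
  by_cases h1 : mass P 1 < 1 / (m : ℝ)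
  · refine ⟨0, 1 / m, by omega, by positivity, fun i => by rw [xTilde, if_pos h1]; simp, ?_, by simp, ?_⟩
    · simp [hP1, hm0.ne']
    · intro l hl hle
      exfalso
      rw [mass_add_one P (by omega : 0 < n)] at h1
      have hhead : ∑ i ∈ Finset.univ.filter (fun i : Fin n => (i : ℕ) < l + 1), P i
          ≤ (l + 1) * P ⟨0, by omega⟩ := by
        have := Finset.sum_le_card_nsmul
          (Finset.univ.filter (fun i : Fin n => (i : ℕ) < l + 1)) P (P ⟨0, by omega⟩)
          (fun i _ => hanti (Fin.mk_le_of_le_val (by omega)))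
        rw [Fin.card_filter_val_lt, min_eq_right (by omega), nsmul_eq_mul] at this
        exact_mod_cast this
      have hl' : ((l : ℝ) + 1) < m := by exact_mod_cast hl
      have h2 : P ⟨l, by omega⟩ ≤ P ⟨0, by omega⟩ := hanti (Fin.mk_le_of_le_val (by simp))
      have h3 := hsplit (l + 1)
      rw [lt_div_iff₀ hm0] at h1
      nlinarith
  · have hprop : ∀ l : ℕ, l + 1 < m →
        ((1 ≤ l + 1 ∧ 1 / ((m : ℝ) - ((l + 1 : ℕ) : ℝ)) *
            ∑ j ∈ Finset.Icc (l + 1 + 1) n, mass P j ≤ mass P (l + 1)) ↔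
          ∑ i ∈ Finset.univ.filter (fun i : Fin n => l + 1 ≤ (i : ℕ)), P i
          ≤ ((m : ℝ) - (l + 1)) * mass P (l + 1)) := by
      intro l hl
      have hl' : (0 : ℝ) < m - (l + 1) := by
        have : ((l : ℝ) + 1) < m := by exact_mod_cast hl
        linarith
      rw [sum_mass_Icc]
      push_cast
      rw [one_div, inv_mul_le_iff₀ hl']
      simp
    have hk : nStar P m ≤ m - 1 := Nat.findGreatest_le _
    have hkm : (0 : ℝ) < m - nStar P m := by
      have : ((nStar P m : ℕ) : ℝ) < m := by exact_mod_cast (by omega : nStar P m < m)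
      linarith
    have hmax : ∀ (l : ℕ) (hl : l + 1 < m),
        ∑ i ∈ Finset.univ.filter (fun i : Fin n => l + 1 ≤ (i : ℕ)), P i
          ≤ ((m : ℝ) - (l + 1)) * P ⟨l, by omega⟩ → l + 1 ≤ nStar P m := by
      intro l hl hle
      refine Nat.le_findGreatest (by omega) ((hprop l hl).2 ?_)
      rwa [mass_add_one P (by omega : l < n)]
    -- `Nat.findGreatest` returns 0 when no index qualifies; this is excluded because P(1) ≥ 1 / m
    -- is the defining condition at index 1.
    have hpos : 1 ≤ nStar P m := by
      refine hmax 0 (by omega) ?_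
      rw [not_lt, mass_add_one P (by omega : 0 < n), div_le_iff₀ hm0] at h1
      have h3 := hsplit 1
      have h4 : ∑ i ∈ Finset.univ.filter (fun i : Fin n => (i : ℕ) < 1), P i
          = P ⟨0, by omega⟩ := by
        have : Finset.univ.filter (fun i : Fin n => (i : ℕ) < 1) = {⟨0, by omega⟩} := by
          ext i; simp [Fin.ext_iff]
        rw [this, Finset.sum_singleton]
      rw [h4] at h3
      simp only [zero_add] at h3 ⊢
      push_cast
      linarith
    refine ⟨nStar P m, 1 / ((m : ℝ) - nStar P m) *
      ∑ i ∈ Finset.univ.filter (fun i : Fin n => nStar P m ≤ (i : ℕ)), P i, by omega, ?_, ?_, ?_,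
      ?_, hmax⟩
    · exact mul_nonneg (by positivity) (Finset.sum_nonneg fun i _ => hP i)
    · intro i
      rw [xTilde, if_neg h1, sum_mass_Icc, mass_add_one P (i.2.trans hmn)]
      simp
    · field_simp
    · intro i hi
      have hspec := Nat.findGreatest_of_ne_zero (P := fun i => 1 ≤ i ∧ 1 / ((m : ℝ) - i) *
        ∑ j ∈ Finset.Icc (i + 1) n, mass P j ≤ mass P i) (n := m - 1) (m := nStar P m) rfl
        (by omega)
      have hspec2 := hspec.2
      rw [sum_mass_Icc] at hspec2
      refine hspec2.trans ?_
      obtain ⟨l, hl⟩ : ∃ l, nStar P m = l + 1 := ⟨nStar P m - 1, by omega⟩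
      rw [hl, mass_add_one P (by omega : l < n)]
      exact hanti (Fin.le_def.2 (by simp; omega))

lemma xTilde_mem_stdSimplex_and_sum_le {n m : ℕ} {P : Fin n → ℝ} (hP : ∀ k, 0 ≤ P k)
    (hP1 : ∑ k, P k = 1) (hanti : Antitone P) (hm : 2 ≤ m) (hmn : m < n) :
    xTilde P m ∈ stdSimplex ℝ (Fin m) ∧
      ∀ φ : ℝ → ℝ, ConvexOn ℝ (Set.Ici 0) φ → ∀ f : Fin n → Fin m,
        ∑ i, φ (xTilde P m i) ≤ ∑ j, φ (push P f j) := by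
  classical
  obtain ⟨k, c, hk, hc, hX, hsum, hcP, -⟩ := xTilde_spec hP hP1 hanti hm hmn
  have hform : ∀ φ : ℝ → ℝ, ∑ i, φ (xTilde P m i) =
      ∑ i ∈ Finset.univ.filter (fun i : Fin n => (i : ℕ) < k), φ (P i) + ((m : ℝ) - k) * φ c := by
    intro φ
    rw [← Finset.sum_filter_add_sum_filter_not Finset.univ (fun i : Fin m => (i : ℕ) < k)]
    congr 1
    · refine Finset.sum_bij (fun i _ => ⟨i, i.2.trans hmn⟩) ?_ ?_ ?_ ?_
      · intro i hi; simpa using hi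
      · intro i _ j _ h; simpa [Fin.ext_iff] using h
      · intro i hi
        simp at hi
        exact ⟨⟨i, by omega⟩, by simpa using hi, rfl⟩
      · intro i hi
        simp at hi
        rw [hX, if_pos hi]
    · have : ∀ i ∈ Finset.univ.filter (fun i : Fin m => ¬ (i : ℕ) < k),
          φ (xTilde P m i) = φ c := by
        intro i hi
        simp only [Finset.mem_filter] at hi
        rw [hX, if_neg hi.2]
      rw [Finset.sum_congr rfl this, Finset.sum_const, Finset.filter_not,
        Finset.card_sdiff_of_subset (Finset.subset_univ _), Fin.card_filter_val_lt,
        min_eq_right hk.le, Finset.card_univ, Fintype.card_fin, nsmul_eq_mul, Nat.cast_sub hk.le]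
  refine ⟨⟨fun i => ?_, ?_⟩, fun φ hφ f => ?_⟩
  · rw [hX]; split_ifs
    · exact hP _
    · exact hc
  · have := hform id
    simp only [id] at this
    rw [this, hsum, ← hP1, ← Finset.sum_filter_add_sum_filter_not Finset.univ
      (fun i : Fin n => (i : ℕ) < k)]
    simp
  · rw [hform]
    exact convexOn_sum_le_sum_push hφ hP f hc hcP hsum (by omega)

/-! ### Extremality of Ỹ_m -/

/-- The map that collects the first `n - m + 1` points in the first block. -/
def collectFirst {n m : ℕ} (hm : 2 ≤ m) (i : Fin n) : Fin m :=
  ⟨(i : ℕ) - (n - m), by omega⟩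

lemma collectFirst_surjective {n m : ℕ} (hm : 2 ≤ m) (hmn : m < n) :
    Function.Surjective (collectFirst hm : Fin n → Fin m) := fun j =>
  ⟨⟨n - m + j, by omega⟩, Fin.ext (by simp [collectFirst])⟩

lemma yTilde_eq_push {n m : ℕ} (P : Fin n → ℝ) (hm : 2 ≤ m) (hmn : m < n) :
    yTilde P m = push P (collectFirst hm) := by
  classical
  funext j
  rw [yTilde, push]
  split_ifs with h
  · rw [sum_mass_Icc_one P (by omega)]
    refine Finset.sum_congr ?_ fun _ _ => rfl
    ext i
    simp [collectFirst, Fin.ext_iff]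
    omega
  · have : Finset.univ.filter (fun k : Fin n => collectFirst hm k = j)
        = {⟨n - m + j, by omega⟩} := by
      ext i
      simp [collectFirst, Fin.ext_iff]
      omega
    rw [this, Finset.sum_singleton, ← add_assoc, mass_add_one P (by omega)]

/-- Among the mass functions obtained by merging into exactly `m` masses, none is more
concentrated than `Ỹ_m`. -/
lemma sum_push_le_sum_yTilde {n m : ℕ} {P : Fin n → ℝ} (hP : ∀ k, 0 ≤ P k)
    (hanti : Antitone P) (hm : 2 ≤ m) (hmn : m < n) {φ : ℝ → ℝ} (hφ : ConvexOn ℝ (Set.Ici 0) φ)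
    {f : Fin n → Fin m} (hf : Function.Surjective f) :
    ∑ j, φ (push P f j) ≤ ∑ i, φ (yTilde P m i) := by
  classical
  obtain ⟨M, rfl⟩ : ∃ M, m = M + 1 := ⟨m - 1, by omega⟩
  let z : Fin n := ⟨0, by omega⟩
  obtain ⟨g, hg⟩ := hf.hasRightInverse
  -- One representative per fibre, chosen so that the point `z` of largest mass represents its own
  -- fibre; `e` then lists the representatives in increasing order, beginning with `z`.
  let r : Fin (M + 1) → Fin n := fun j => if j = f z then z else g j
  have hr : ∀ j, f (r j) = j := by
    intro j
    by_cases h : j = f z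
    · simp [r, h]
    · simp only [r, h, if_false]; exact hg j
  have hrinj : Function.Injective r := fun i j h => by rw [← hr i, h, hr j]
  let R : Finset (Fin n) := Finset.univ.image r
  have hR : R.card = M + 1 := by
    rw [Finset.card_image_of_injective _ hrinj]; simp
  let e := R.orderEmbOfFin hR
  have hfe : Function.Injective (f ∘ e) := by
    intro i j h
    have hi : e i ∈ R := R.orderEmbOfFin_mem hR i
    have hj : e j ∈ R := R.orderEmbOfFin_mem hR j
    simp only [R, Finset.mem_image, Finset.mem_univ, true_and] at hi hj
    obtain ⟨a, ha⟩ := hi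
    obtain ⟨b, hb⟩ := hj
    apply e.injective
    simp only [Function.comp, ← ha, ← hb, hr] at h
    rw [← ha, ← hb, h]
  have hbij : Function.Bijective (f ∘ e) := Finite.injective_iff_bijective.1 hfe
  have hzR : z ∈ R := Finset.mem_image.2 ⟨f z, by simp, by simp [r]⟩
  have he0 : e 0 = z := by
    obtain ⟨i, hi⟩ : z ∈ Set.range e := by
      rw [Finset.range_orderEmbOfFin]; exact hzR
    have h1 : e 0 ≤ e i := e.monotone (Fin.zero_le i)
    rw [hi] at h1
    exact le_antisymm h1 (Fin.mk_le_of_le_val (by simp))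
  -- At least d indices lie beyond `e i`, since d representatives follow it. Hence the mass at `e i`
  -- is at least the corresponding mass of Ỹ_m.
  have hebound : ∀ (d : ℕ) (i : Fin (M + 1)), (i : ℕ) + d = M → (e i : ℕ) + d + 1 ≤ n := by
    intro d
    induction d with
    | zero => intro i _; have := (e i).2; omega
    | succ d ih =>
      intro i hi
      have h1 := ih ⟨i + 1, by omega⟩ (by simp; omega)
      have h2 : e i < e ⟨i + 1, by omega⟩ := e.strictMono (by simp [Fin.lt_def])
      rw [Fin.lt_def] at h2
      omega
  set Y := yTilde P (M + 1) with hYdef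
  have hYsucc : ∀ i : Fin M, Y i.succ = P ⟨n - (M + 1) + (i + 1), by omega⟩ := by
    intro i
    rw [hYdef, yTilde, if_neg (by simp), ← add_assoc, mass_add_one P (by simp; omega)]
    rfl
  have hYle : ∀ i : Fin M, Y i.succ ≤ push P f ((f ∘ e) i.succ) := by
    intro i
    rw [hYsucc]
    refine le_trans (hanti ?_) (le_push hP f (e i.succ))
    rw [Fin.le_def]
    have := hebound (M - (i + 1)) i.succ (by simp)
    simp only
    omega
  have hY0 : ∀ i : Fin M, Y i.succ ≤ push P f ((f ∘ e) 0) := by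
    intro i
    rw [hYsucc]
    simp only [Function.comp, he0]
    exact le_trans (hanti (Fin.mk_le_of_le_val (by simp))) (le_push hP f z)
  have hYnonneg : ∀ i : Fin M, 0 ≤ Y i.succ := fun i => by rw [hYsucc]; exact hP _
  have hre : ∀ φ : ℝ → ℝ, ∑ j, φ (push P f j) = ∑ i, φ (push P f ((f ∘ e) i)) := fun φ =>
    (Function.Bijective.sum_comp hbij (fun j => φ (push P f j))).symm
  -- Every block except that of `z` is cut down to its mass in Ỹ_m, and the excess goes to the block
  -- of `z`, which thereby reaches `Y 0`.
  have hkey := convexOn_sum_increment_le hφ (Finset.univ : Finset (Fin M)) (fun i => Y i.succ)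
    (fun i => push P f ((f ∘ e) i.succ) - Y i.succ) (T := push P f ((f ∘ e) 0))
    (fun i _ => hYnonneg i) (fun i _ => hY0 i) (fun i _ => sub_nonneg.2 (hYle i))
  have htot : ∑ i, Y i = ∑ i, push P f ((f ∘ e) i) := by
    have := hre id
    simp only [id] at this
    rw [← this, hYdef, yTilde_eq_push P hm hmn, sum_push, sum_push]
  rw [Fin.sum_univ_succ, Fin.sum_univ_succ (fun i => push P f ((f ∘ e) i))] at htot
  rw [hre, Fin.sum_univ_succ, Fin.sum_univ_succ (fun i => φ (Y i))]
  have hT : push P f ((f ∘ e) 0) + ∑ i : Fin M, (push P f ((f ∘ e) i.succ) - Y i.succ) = Y 0 := by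
    rw [Finset.sum_sub_distrib]; linarith
  rw [hT] at hkey
  simp only [add_sub_cancel, Finset.sum_sub_distrib] at hkey
  linarith

/-! ### The Huffman algorithm -/

/-- The Huffman algorithm keeps a partition in which each composite block has at most twice the
mass of any block. -/
lemma HuffmanReachable.invariant {n : ℕ} {P : Fin n → ℝ} (hP : ∀ k, 0 ≤ P k)
    {S : Finset (Finset (Fin n))} (h : HuffmanReachable P S) :
    (∀ A ∈ S, A.Nonempty) ∧ (∀ A ∈ S, ∀ B ∈ S, A ≠ B → Disjoint A B) ∧
      (∀ k, ∃ A ∈ S, k ∈ A) ∧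
      ∀ C ∈ S, (∃ k, C = {k}) ∨ ∀ D ∈ S, ∑ k ∈ C, P k ≤ 2 * ∑ k ∈ D, P k := by
  induction h with
  | start =>
    refine ⟨?_, ?_, fun k => ⟨{k}, by simp, by simp⟩, ?_⟩
    · simp
    · simp only [Finset.mem_image, Finset.mem_univ, true_and]
      rintro _ ⟨a, rfl⟩ _ ⟨b, rfl⟩ hab
      simpa [eq_comm] using hab
    · simp only [Finset.mem_image, Finset.mem_univ, true_and]
      rintro _ ⟨a, rfl⟩
      exact Or.inl ⟨a, rfl⟩
  | merge S A B hS hA hB hAB hminA hminB ih =>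
    obtain ⟨hne, hdisj, hcov, hcomp⟩ := ih
    have hnn : ∀ C : Finset (Fin n), 0 ≤ ∑ k ∈ C, P k := fun C =>
      Finset.sum_nonneg fun k _ => hP k
    have hU : ∑ k ∈ A ∪ B, P k = ∑ k ∈ A, P k + ∑ k ∈ B, P k :=
      Finset.sum_union (hdisj A hA B hB hAB)
    have hmem : ∀ C, C ∈ insert (A ∪ B) ((S.erase A).erase B) ↔
        C = A ∪ B ∨ (C ≠ B ∧ C ≠ A ∧ C ∈ S) := by simp
    refine ⟨?_, ?_, ?_, ?_⟩
    · intro C hC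
      rcases (hmem C).1 hC with rfl | ⟨-, -, h⟩
      · exact (hne A hA).mono Finset.subset_union_left
      · exact hne C h
    · intro C hC D hD hCD
      rcases (hmem C).1 hC with rfl | ⟨h1, h2, h3⟩ <;>
        rcases (hmem D).1 hD with rfl | ⟨h4, h5, h6⟩
      · exact absurd rfl hCD
      · exact Finset.disjoint_union_left.2
          ⟨hdisj A hA D h6 h5.symm, hdisj B hB D h6 h4.symm⟩
      · exact Finset.disjoint_union_right.2 ⟨hdisj C h3 A hA h2, hdisj C h3 B hB h1⟩
      · exact hdisj C h3 D h6 hCD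
    · intro k
      obtain ⟨C, hC, hk⟩ := hcov k
      by_cases h1 : C = A
      · exact ⟨A ∪ B, (hmem _).2 (Or.inl rfl), Finset.mem_union_left _ (h1 ▸ hk)⟩
      by_cases h2 : C = B
      · exact ⟨A ∪ B, (hmem _).2 (Or.inl rfl), Finset.mem_union_right _ (h2 ▸ hk)⟩
      exact ⟨C, (hmem _).2 (Or.inr ⟨h2, h1, hC⟩), hk⟩
    · intro C hC
      rcases (hmem C).1 hC with rfl | ⟨h1, h2, h3⟩
      · refine Or.inr fun D hD => ?_
        rcases (hmem D).1 hD with rfl | ⟨h4, h5, h6⟩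
        · linarith [hnn (A ∪ B)]
        -- Both merged blocks were no heavier than D.
        · rw [hU]; linarith [hminA D h6, hminB D h6 h5]
      · refine (hcomp C h3).imp_right fun h D hD => ?_
        rcases (hmem D).1 hD with rfl | ⟨h4, h5, h6⟩
        -- The new block is at least as heavy as A, so older bounds persist.
        · rw [hU]; linarith [h A hA, hnn B]
        · exact h D h6

lemma exists_huffmanReachable_card {n : ℕ} {P : Fin n → ℝ} (hP : ∀ k, 0 ≤ P k) (d : ℕ)
    (hd : d < n) : ∃ S, HuffmanReachable P S ∧ S.card + d = n := by
  classical
  induction d with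
  | zero =>
    refine ⟨_, .start, ?_⟩
    rw [Finset.card_image_of_injective _ Finset.singleton_injective]
    simp
  | succ d ih =>
    obtain ⟨S, hS, hcard⟩ := ih (by omega)
    obtain ⟨A, hA, hminA⟩ := S.exists_min_image (fun C => ∑ k ∈ C, P k)
      (Finset.card_pos.1 (by omega))
    have hcardA : (S.erase A).card = S.card - 1 := Finset.card_erase_of_mem hA
    obtain ⟨B, hB, hminB⟩ := (S.erase A).exists_min_image (fun C => ∑ k ∈ C, P k)
      (Finset.card_pos.1 (by omega))
    have hB' := Finset.mem_erase.1 hB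
    obtain ⟨hne, hdisj, -, -⟩ := hS.invariant hP
    refine ⟨_, .merge S A B hS hA hB'.2 hB'.1.symm hminA
      (fun C hC hCA => hminB C (Finset.mem_erase.2 ⟨hCA, hC⟩)), ?_⟩
    rw [Finset.card_insert_of_notMem, Finset.card_erase_of_mem hB, hcardA]
    · omega
    -- Were A ∪ B already another block, it would be disjoint from the nonempty A.
    · intro hmem
      have h1 := Finset.mem_erase.1 hmem
      have h2 := Finset.mem_erase.1 h1.2
      have h3 := hdisj _ h2.2 A hA h2.1
      obtain ⟨x, hx⟩ := hne A hA
      exact Finset.disjoint_left.1 h3 (Finset.mem_union_left _ hx) hx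

lemma IsHuffmanMap.surjective {n m : ℕ} {P : Fin n → ℝ} (hP : ∀ k, 0 ≤ P k) {f : Fin n → Fin m}
    (h : IsHuffmanMap P f) : Function.Surjective f := by
  obtain ⟨S, hS, -, hSf, -⟩ := h
  intro j
  obtain ⟨k, hk⟩ := (hS.invariant hP).1 (Finset.univ.filter fun k => f k = j)
    (hSf ▸ Finset.mem_image_of_mem _ (Finset.mem_univ j))
  exact ⟨k, by simpa using hk⟩

lemma exists_isHuffmanMap {n m : ℕ} {P : Fin n → ℝ} (hP : ∀ k, 0 ≤ P k) (hm : 2 ≤ m)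
    (hmn : m < n) : ∃ f : Fin n → Fin m, IsHuffmanMap P f := by
  classical
  obtain ⟨S, hS, hcard⟩ := exists_huffmanReachable_card hP (n - m) (by omega)
  have hSm : S.card = m := by omega
  obtain ⟨hne, hdisj, hcov, -⟩ := hS.invariant hP
  let e : Fin m ≃ S := (finCongr hSm.symm).trans S.equivFin.symm
  -- The sign is reversed because `Tuple.sort` sorts increasingly.
  let F : Fin m → ℝ := fun j => -∑ k ∈ (e j : Finset (Fin n)), P k
  let g : Fin m ≃ S := (Tuple.sort F).trans e
  have hmono : Monotone (F ∘ Tuple.sort F) := Tuple.monotone_sort F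
  choose c hc hkc using hcov
  let f : Fin n → Fin m := fun k => g.symm ⟨c k, hc k⟩
  have hfib : ∀ j, (Finset.univ.filter fun k => f k = j) = (g j : Finset (Fin n)) := by
    intro j
    ext k
    simp only [Finset.mem_filter, Finset.mem_univ, true_and, f, Equiv.symm_apply_eq]
    constructor
    · intro h
      have := hkc k
      rw [← h]; exact this
    · intro h
      by_contra hne'
      have h1 : c k ≠ g j := fun h' => hne' (Subtype.ext h')
      exact Finset.disjoint_left.1 (hdisj _ (hc k) _ (g j).2 h1) (hkc k) h
  refine ⟨f, S, hS, hSm, ?_, ?_⟩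
  · ext C
    simp only [hfib, Finset.mem_image, Finset.mem_univ, true_and]
    constructor
    · intro hC
      exact ⟨g.symm ⟨C, hC⟩, by simp⟩
    · rintro ⟨j, rfl⟩
      exact (g j).2
  · intro i j hij
    simp only [hfib]
    have := hmono hij
    simp only [F, Function.comp] at this
    exact neg_le_neg_iff.1 this

/-- A Huffman mass function agrees with `X̃_m` up to masses whose ratios are at most `2`. -/
lemma IsHuffmanMap.exists_levels {n m : ℕ} {P : Fin n → ℝ} (hP : ∀ k, 0 ≤ P k)
    (hP1 : ∑ k, P k = 1) (hanti : Antitone P) (hm : 2 ≤ m) (hmn : m < n) {f : Fin n → Fin m}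
    (h : IsHuffmanMap P f) :
    ∃ (K W : Finset (Fin m)) (p : ℝ), K.Nonempty ∧ K.card = W.card ∧ 0 ≤ p ∧
      (∀ j ∈ K, p ≤ push P f j ∧ push P f j ≤ 2 * p) ∧
      ∀ φ : ℝ → ℝ, ∑ j ∈ Kᶜ, φ (push P f j) = ∑ i ∈ Wᶜ, φ (xTilde P m i) := by
  classical
  obtain ⟨S, hS, -, hSf, -⟩ := h
  obtain ⟨-, -, -, hcomp⟩ := hS.invariant hP
  have hfS : ∀ j, (Finset.univ.filter fun k => f k = j) ∈ S := fun j =>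
    hSf ▸ Finset.mem_image_of_mem _ (Finset.mem_univ j)
  have hblock : ∀ j, (∃ k, (Finset.univ.filter fun k => f k = j) = {k}) ∨
      ∀ i, push P f j ≤ 2 * push P f i := fun j =>
    (hcomp _ (hfS j)).imp_right fun h i => h _ (hfS i)
  have hQ := push_nonneg hP f
  have : Nonempty (Fin m) := ⟨⟨0, by omega⟩⟩
  obtain ⟨j₀, hj₀⟩ := Finite.exists_min (push P f)
  obtain ⟨p, hp⟩ : ∃ p, p = push P f j₀ := ⟨_, rfl⟩
  rw [← hp] at hj₀
  have hp0 : 0 ≤ p := hp ▸ hQ j₀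
  have hsingle : ∀ j, 2 * p < push P f j → ∃ k, (Finset.univ.filter fun k => f k = j) = {k} :=
    fun j hj => (hblock j).resolve_right fun h => by have := h j₀; rw [← hp] at this; linarith
  -- `Kᶜ` collects the blocks heavier than 2p. They are singletons, since a composite block is at
  -- most 2p, and so correspond bijectively to the points of `A`.
  let K : Finset (Fin m) := Finset.univ.filter fun j => push P f j ≤ 2 * p
  let A : Finset (Fin n) := Finset.univ.filter fun k => 2 * p < P k
  have hKc : ∀ j, j ∈ Kᶜ ↔ 2 * p < push P f j := by simp [K]
  have hA : ∀ k, k ∈ A ↔ 2 * p < P k := by simp [A]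
  have hpushA : ∀ k ∈ A, push P f (f k) = P k ∧ ∀ l, f l = f k → l = k := by
    intro k hk
    obtain ⟨k', hk'⟩ := hsingle (f k) (((hA k).1 hk).trans_le (le_push hP f k))
    have h1 : ∀ l, f l = f k → l = k' := fun l hl => by
      have : l ∈ Finset.univ.filter fun x => f x = f k := by simpa using hl
      rw [hk'] at this; simpa using this
    obtain rfl := h1 k rfl
    exact ⟨by rw [push, hk', Finset.sum_singleton], h1⟩
  have hφK : ∀ φ : ℝ → ℝ, ∑ j ∈ Kᶜ, φ (push P f j) = ∑ k ∈ A, φ (P k) := by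
    intro φ
    symm
    refine Finset.sum_bij (fun k _ => f k) ?_ ?_ ?_ ?_
    · intro k hk
      rw [hKc, (hpushA k hk).1]; exact (hA k).1 hk
    · intro k hk l hl hkl
      exact (hpushA l hl).2 k hkl
    · intro j hj
      obtain ⟨k, hk⟩ := hsingle j ((hKc j).1 hj)
      have hfk : f k = j := by
        have : k ∈ Finset.univ.filter fun k => f k = j := by rw [hk]; simp
        simpa using this
      refine ⟨k, ?_, hfk⟩
      rw [hA]
      have := (hKc j).1 hj
      rwa [push, hk, Finset.sum_singleton] at this
    · intro k hk
      rw [(hpushA k hk).1]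
  obtain ⟨s, c, hsm, -, hX, -, -, hmax⟩ := xTilde_spec hP hP1 hanti hm hmn
  have hcardA : A.card = Kᶜ.card := by
    have := hφK fun _ => 1
    simp only [Finset.sum_const, nsmul_eq_mul, mul_one] at this
    exact_mod_cast this.symm
  have hj₀K : j₀ ∈ K := by
    simp only [K, Finset.mem_filter, Finset.mem_univ, true_and]
    rw [← hp]; linarith
  have hKle : Kᶜ.card + K.card = m := by
    rw [add_comm, Finset.card_add_card_compl, Fintype.card_fin]
  have hKpos : 0 < K.card := Finset.card_pos.2 ⟨j₀, hj₀K⟩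
  -- X̃_m keeps all points of `A`. These form an initial segment ending at l, and the masses after l
  -- fill the m - (l + 1) blocks of `K`, each at most 2p < P l; thus the condition defining n* holds
  -- at the one-based index l + 1.
  have hAs : ∀ k ∈ A, (k : ℕ) < s := by
    intro k hk
    have hAne : A.Nonempty := ⟨k, hk⟩
    let l := A.max' hAne
    have hl : l ∈ A := A.max'_mem hAne
    have hAl : ∀ i : Fin n, i ∈ A ↔ (i : ℕ) < l + 1 := by
      intro i
      constructor
      · intro hi
        have := A.le_max' i hi
        rw [Fin.le_def] at this
        omega
      · intro hi
        rw [hA]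
        exact ((hA l).1 hl).trans_le (hanti (Fin.le_def.2 (by omega)))
    have hAcard : A.card = l + 1 := by
      have : A = Finset.univ.filter fun i : Fin n => (i : ℕ) < l + 1 := by
        ext i; rw [hAl]; simp
      rw [this, Fin.card_filter_val_lt, min_eq_right]
      have := l.2
      omega
    have hlt : (l : ℕ) + 1 < m := by omega
    have hle := hmax l hlt ?_
    · have := (hAl k).1 hk
      omega
    · have h1 : ∑ i ∈ Finset.univ.filter (fun i : Fin n => (l : ℕ) + 1 ≤ (i : ℕ)), P i =
          ∑ j ∈ K, push P f j := by
        have h2 := hφK id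
        simp only [id] at h2
        have h3 : ∑ j ∈ K, push P f j + ∑ j ∈ Kᶜ, push P f j = ∑ k, P k := by
          rw [Finset.sum_add_sum_compl, sum_push]
        have h4 : Finset.univ.filter (fun i : Fin n => (l : ℕ) + 1 ≤ (i : ℕ)) = Aᶜ := by
          ext i
          rw [Finset.mem_compl, hAl]; simp
        have h5 := Finset.sum_add_sum_compl A P
        rw [h4]
        linarith
      rw [h1]
      have h2 : ∑ j ∈ K, push P f j ≤ K.card • (2 * p) :=
        Finset.sum_le_card_nsmul _ _ _ fun j hj => by simpa [K] using hj
      have h3 : (K.card : ℝ) = m - (l + 1) := by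
        have h4 : K.card + ((l : ℕ) + 1) = m := by omega
        have h5 : (K.card : ℝ) + ((l : ℕ) + 1) = m := by exact_mod_cast h4
        linarith
      rw [nsmul_eq_mul] at h2
      refine h2.trans ?_
      rw [h3]
      refine mul_le_mul_of_nonneg_left ((hA l).1 hl).le ?_
      rw [← h3]; exact Nat.cast_nonneg _
  let L : Finset (Fin m) := Finset.univ.filter fun i => (⟨i, i.2.trans hmn⟩ : Fin n) ∈ A
  have hφL : ∀ φ : ℝ → ℝ, ∑ k ∈ A, φ (P k) = ∑ i ∈ L, φ (xTilde P m i) := by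
    intro φ
    symm
    refine Finset.sum_bij (fun i _ => ⟨i, i.2.trans hmn⟩) ?_ ?_ ?_ ?_
    · intro i hi
      simpa [L] using hi
    · intro i _ j _ hij
      simpa [Fin.ext_iff] using hij
    · intro k hk
      exact ⟨⟨k, (hAs k hk).trans hsm⟩, by simpa [L] using hk, rfl⟩
    · intro i hi
      have hi' : (⟨i, i.2.trans hmn⟩ : Fin n) ∈ A := by simpa [L] using hi
      rw [hX, if_pos (hAs _ hi')]
  have hLcard : A.card = L.card := by
    have := hφL fun _ => 1
    simp only [Finset.sum_const, nsmul_eq_mul, mul_one] at this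
    exact_mod_cast this
  refine ⟨K, Lᶜ, p, ⟨j₀, hj₀K⟩, ?_, hp0, fun j hj => ⟨hj₀ j, by simpa [K] using hj⟩, fun φ => ?_⟩
  · have := Finset.card_add_card_compl L
    rw [Fintype.card_fin] at this
    omega
  · rw [compl_compl, hφK, hφL]

/-! ### Chord against graph: the constant v(α) -/

/-- The factor `exp ((α - 1) v(α))` by which a sum of `α`-th powers of masses can differ from the
one of equal masses when the ratios of the masses are at most `2`. -/
noncomputable def powerFactor (α : ℝ) : ℝ :=
  ((α - 1) / ((2 : ℝ) ^ α - 2)) ^ (α - 1) * (α / ((2 : ℝ) ^ α - 1)) ^ (-α)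

lemma two_rpow_sub_one_pos {α : ℝ} (hα : 0 < α) : 0 < (2 : ℝ) ^ α - 1 :=
  sub_pos.2 (Real.one_lt_rpow (by norm_num) hα)

lemma sub_one_div_two_rpow_sub_two_pos {α : ℝ} (hα1 : α ≠ 1) :
    0 < (α - 1) / ((2 : ℝ) ^ α - 2) := by
  rcases lt_or_gt_of_ne hα1 with h | h
  · refine div_pos_of_neg_of_neg (by linarith) ?_
    have := Real.rpow_lt_rpow_of_exponent_lt (x := 2) (by norm_num) h
    rw [Real.rpow_one] at this
    linarith
  · refine div_pos (by linarith) ?_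
    have := Real.rpow_lt_rpow_of_exponent_lt (x := 2) (by norm_num) h
    rw [Real.rpow_one] at this
    linarith

lemma powerFactor_pos {α : ℝ} (hα : 0 < α) (hα1 : α ≠ 1) : 0 < powerFactor α :=
  mul_pos (Real.rpow_pos_of_pos (sub_one_div_two_rpow_sub_two_pos hα1) _)
    (Real.rpow_pos_of_pos (div_pos hα (two_rpow_sub_one_pos hα)) _)

lemma logb_powerFactor (b : ℝ) {α : ℝ} (hα : 0 < α) (hα1 : α ≠ 1) :
    Real.logb b (powerFactor α) = (α - 1) * v b α := by
  have h1 := sub_one_div_two_rpow_sub_two_pos hα1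
  have h2 := div_pos hα (two_rpow_sub_one_pos hα)
  have h3 : α - 1 ≠ 0 := sub_ne_zero.2 hα1
  rw [powerFactor, Real.logb_mul (Real.rpow_pos_of_pos h1 _).ne' (Real.rpow_pos_of_pos h2 _).ne',
    Real.logb_rpow_eq_mul_logb_of_pos h1, Real.logb_rpow_eq_mul_logb_of_pos h2, v, if_neg hα1]
  field_simp
  ring

/-- The tangent of `x ↦ x ^ α` at `u` lies below the graph if `1 ≤ α`. -/
lemma rpow_tangent_le {α u w : ℝ} (hα : 1 ≤ α) (hu : 0 < u) (hw : 0 ≤ w) :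
    u ^ (α - 1) * (α * w - (α - 1) * u) ≤ w ^ α := by
  have h := one_add_mul_self_le_rpow_one_add (s := w / u - 1)
    (by linarith [div_nonneg hw hu.le]) hα
  rw [add_sub_cancel, Real.div_rpow hw hu.le, le_div_iff₀ (Real.rpow_pos_of_pos hu _)] at h
  refine le_trans (le_of_eq ?_) h
  rw [Real.rpow_sub_one hu.ne']
  field_simp
  ring

lemma le_rpow_tangent {α u w : ℝ} (hα0 : 0 ≤ α) (hα : α ≤ 1) (hu : 0 < u) (hw : 0 ≤ w) :
    w ^ α ≤ u ^ (α - 1) * (α * w - (α - 1) * u) := by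
  have h := rpow_one_add_le_one_add_mul_self (s := w / u - 1)
    (by linarith [div_nonneg hw hu.le]) hα0 hα
  rw [add_sub_cancel, Real.div_rpow hw hu.le, div_le_iff₀ (Real.rpow_pos_of_pos hu _)] at h
  refine le_trans h (le_of_eq ?_)
  rw [Real.rpow_sub_one hu.ne']
  field_simp
  ring

/-- The chord of `x ↦ x ^ α` over `[q, 2q]`, at `c`, as a scaled tangent. -/
lemma rpow_chord_eq {α q c : ℝ} (hα : 0 < α) (hα1 : α ≠ 1) (hq : 0 < q) (hc : 0 < c) :
    ∃ u w : ℝ, ∃ r : ℝ, 0 < u ∧ 0 < w ∧ 0 < r ∧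
      q ^ α + ((2 * q) ^ α - q ^ α) / q * (c - q) = r * (u ^ (α - 1) * (α * w - (α - 1) * u)) ∧
      powerFactor α * c ^ α = r * w ^ α := by
  have h1 := sub_one_div_two_rpow_sub_two_pos hα1
  have h2 := div_pos hα (two_rpow_sub_one_pos hα)
  set B := (α - 1) / ((2 : ℝ) ^ α - 2) with hB
  have hA := two_rpow_sub_one_pos hα
  have h3 : α - 1 ≠ 0 := sub_ne_zero.2 hα1
  have hB2 : (2 : ℝ) ^ α - 2 ≠ 0 := by
    intro h
    rw [hB, h, div_zero] at h1
    exact lt_irrefl _ h1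
  -- Chosen so that α w = (2 ^ α - 1) c, (α - 1) u = (2 ^ α - 2) q and r u ^ (α - 1) = q ^ (α - 1).
  -- Equality of tangent and power, u = w, determines the worst ratio c / q.
  refine ⟨q / B, c / (α / ((2 : ℝ) ^ α - 1)), B ^ (α - 1), by positivity, by positivity,
    by positivity, ?_, ?_⟩
  · rw [Real.div_rpow hq.le h1.le, Real.mul_rpow (by norm_num) hq.le,
      ← mul_assoc, mul_div_cancel₀ _ (Real.rpow_pos_of_pos h1 _).ne', Real.rpow_sub_one hq.ne', hB]
    field_simp
    ring
  · rw [powerFactor, Real.div_rpow hc.le h2.le, Real.rpow_neg h2.le, ← hB]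
    ring

lemma rpow_chord_le {α q c : ℝ} (hα : 1 < α) (hq : 0 < q) (hc : 0 < c) :
    q ^ α + ((2 * q) ^ α - q ^ α) / q * (c - q) ≤ powerFactor α * c ^ α := by
  obtain ⟨u, w, r, hu, hw, hr, h1, h2⟩ := rpow_chord_eq (by linarith) hα.ne' hq hc
  rw [h1, h2]
  exact mul_le_mul_of_nonneg_left (rpow_tangent_le hα.le hu hw.le) hr.le

lemma le_rpow_chord {α q c : ℝ} (hα0 : 0 < α) (hα : α < 1) (hq : 0 < q) (hc : 0 < c) :
    powerFactor α * c ^ α ≤ q ^ α + ((2 * q) ^ α - q ^ α) / q * (c - q) := by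
  obtain ⟨u, w, r, hu, hw, hr, h1, h2⟩ := rpow_chord_eq hα0 hα.ne hq hc
  rw [h1, h2]
  exact mul_le_mul_of_nonneg_left (le_rpow_tangent hα0.le hα.le hu hw.le) hr.le

lemma log_two_div_exp_mul_log_two :
    Real.log (2 / (Real.exp 1 * Real.log 2)) =
      Real.log 2 - 1 - Real.log (Real.log 2) := by
  have h2 : Real.log 2 ≠ 0 := (Real.log_pos (by norm_num)).ne'
  rw [Real.log_div (by norm_num) (mul_ne_zero (Real.exp_ne_zero _) h2),
    Real.log_mul (Real.exp_ne_zero _) h2, Real.log_exp]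
  ring

/-- This is log y ≤ y - 1 at y = 2 q log 2 / c, multiplied by c; it is sharp at c = 2 q log 2. -/
lemma mul_log_chord_le {q c : ℝ} (hq : 0 < q) (hc : 0 < c) :
    q * Real.log q + ((2 * q) * Real.log (2 * q) - q * Real.log q) / q * (c - q)
      ≤ c * Real.log c + c * Real.log (2 / (Real.exp 1 * Real.log 2)) := by
  have h2 : 0 < Real.log 2 := Real.log_pos (by norm_num)
  have h := Real.log_le_sub_one_of_pos (x := 2 * Real.log 2 * q / c) (by positivity)
  rw [Real.log_div (by positivity) hc.ne', Real.log_mul (by positivity) hq.ne',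
    Real.log_mul (by norm_num) h2.ne'] at h
  have h3 := mul_le_mul_of_nonneg_left h hc.le
  have e : c * (2 * Real.log 2 * q / c - 1) = 2 * Real.log 2 * q - c := by field_simp
  rw [e] at h3
  rw [log_two_div_exp_mul_log_two, Real.log_mul (by norm_num) hq.ne']
  have e2 : (2 * q * (Real.log 2 + Real.log q) - q * Real.log q) / q * (c - q)
      = (2 * Real.log 2 + Real.log q) * (c - q) := by field_simp; ring
  rw [e2]
  linarith

/-- A convex sum over arguments in `[q, 2q]` is at most the value of the chord at the mean. -/
lemma convexOn_sum_le_chord {φ : ℝ → ℝ} (hφ : ConvexOn ℝ (Set.Ici 0) φ) {ι : Type*}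
    {K : Finset ι} (hK : K.Nonempty) {a : ι → ℝ} {q : ℝ} (hq : 0 < q)
    (ha : ∀ i ∈ K, q ≤ a i ∧ a i ≤ 2 * q) :
    ∑ i ∈ K, φ (a i) ≤
      K.card * (φ q + (φ (2 * q) - φ q) / q * ((∑ i ∈ K, a i) / K.card - q)) := by
  have h1 : ∀ i ∈ K, φ (a i) ≤ φ q + (φ (2 * q) - φ q) / q * (a i - q) := by
    intro i hi
    obtain ⟨h1, h2⟩ := ha i hi
    have h := hφ.2 (show q ∈ Set.Ici 0 from hq.le)
      (show 2 * q ∈ Set.Ici 0 from (by positivity : 0 ≤ 2 * q))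
      (show 0 ≤ 1 - (a i - q) / q by rw [sub_nonneg, div_le_one hq]; linarith) (div_nonneg (sub_nonneg.2 h1) hq.le) (by ring)
    simp only [smul_eq_mul] at h
    have e : (1 - (a i - q) / q) * q + (a i - q) / q * (2 * q) = a i := by field_simp; ring
    rw [e] at h
    refine h.trans (le_of_eq ?_)
    field_simp
    ring
  refine (Finset.sum_le_sum h1).trans (le_of_eq ?_)
  have hK' : (K.card : ℝ) ≠ 0 := by exact_mod_cast (Finset.card_pos.2 hK).ne'
  rw [Finset.sum_add_distrib, ← Finset.mul_sum, Finset.sum_sub_distrib, Finset.sum_const,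
    Finset.sum_const, nsmul_eq_mul, nsmul_eq_mul]
  field_simp

section levels

variable {ι : Type*} {K : Finset ι} {a : ι → ℝ} {q : ℝ}

/-- Separates off the degenerate case q = 0, which occurs when Huffman blocks have mass zero and
where the chord is meaningless. -/
lemma sum_eq_zero_or_mean_pos (hK : K.Nonempty) (hq : 0 ≤ q)
    (ha : ∀ i ∈ K, q ≤ a i ∧ a i ≤ 2 * q) :
    (∀ i ∈ K, a i = 0) ∨ (0 < q ∧ 0 < (∑ i ∈ K, a i) / K.card) := by
  rcases hq.eq_or_lt with rfl | hq
  · left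
    intro i hi
    have := ha i hi
    linarith
  · right
    refine ⟨hq, div_pos (Finset.sum_pos (fun i hi => hq.trans_le (ha i hi).1) hK) ?_⟩
    exact_mod_cast Finset.card_pos.2 hK

lemma sum_rpow_le {α : ℝ} (hα : 1 < α) (hK : K.Nonempty) (hq : 0 ≤ q)
    (ha : ∀ i ∈ K, q ≤ a i ∧ a i ≤ 2 * q) :
    ∑ i ∈ K, a i ^ α ≤ powerFactor α * (K.card * ((∑ i ∈ K, a i) / K.card) ^ α) := by
  rcases sum_eq_zero_or_mean_pos hK hq ha with h | ⟨hq, hc⟩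
  · have h0 : α ≠ 0 := by linarith
    rw [Finset.sum_eq_zero h, Finset.sum_eq_zero fun i hi => by rw [h i hi, Real.zero_rpow h0]]
    simp [Real.zero_rpow h0]
  · refine (convexOn_sum_le_chord (convexOn_rpow hα.le) hK hq ha).trans ?_
    rw [mul_left_comm]
    exact mul_le_mul_of_nonneg_left (rpow_chord_le hα hq hc) (Nat.cast_nonneg _)

lemma le_sum_rpow {α : ℝ} (hα0 : 0 < α) (hα : α < 1) (hK : K.Nonempty) (hq : 0 ≤ q)
    (ha : ∀ i ∈ K, q ≤ a i ∧ a i ≤ 2 * q) :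
    powerFactor α * (K.card * ((∑ i ∈ K, a i) / K.card) ^ α) ≤ ∑ i ∈ K, a i ^ α := by
  rcases sum_eq_zero_or_mean_pos hK hq ha with h | ⟨hq, hc⟩
  · rw [Finset.sum_eq_zero h,
      Finset.sum_eq_zero fun i hi => by rw [h i hi, Real.zero_rpow hα0.ne']]
    simp [Real.zero_rpow hα0.ne']
  · have h := convexOn_sum_le_chord (Real.concaveOn_rpow hα0.le hα.le).neg hK hq ha
    have h2 := mul_le_mul_of_nonneg_left (le_rpow_chord hα0 hα hq hc)
      (Nat.cast_nonneg (α := ℝ) K.card)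
    simp only [Pi.neg_apply, Finset.sum_neg_distrib] at h
    rw [mul_left_comm]
    refine h2.trans ?_
    rw [← neg_le_neg_iff]
    refine h.trans (le_of_eq ?_)
    ring

lemma sum_mul_log_le (hK : K.Nonempty) (hq : 0 ≤ q) (ha : ∀ i ∈ K, q ≤ a i ∧ a i ≤ 2 * q) :
    ∑ i ∈ K, a i * Real.log (a i) ≤
      K.card * ((∑ i ∈ K, a i) / K.card * Real.log ((∑ i ∈ K, a i) / K.card)) +
        (∑ i ∈ K, a i) * Real.log (2 / (Real.exp 1 * Real.log 2)) := by
  rcases sum_eq_zero_or_mean_pos hK hq ha with h | ⟨hq, hc⟩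
  · rw [Finset.sum_eq_zero h, Finset.sum_eq_zero fun i hi => by rw [h i hi, zero_mul]]
    simp
  · refine (convexOn_sum_le_chord Real.convexOn_mul_log hK hq ha).trans ?_
    have h := mul_le_mul_of_nonneg_left (mul_log_chord_le hq hc)
      (Nat.cast_nonneg (α := ℝ) K.card)
    refine h.trans (le_of_eq ?_)
    have hK' : (K.card : ℝ) ≠ 0 := by exact_mod_cast (Finset.card_pos.2 hK).ne'
    rw [mul_add, ← mul_assoc (K.card : ℝ) ((∑ i ∈ K, a i) / K.card)
      (Real.log (2 / (Real.exp 1 * Real.log 2))), mul_div_cancel₀ _ hK']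

end levels

/-- At c = q the chord meets the graph, which forces the sign of the loss. With it, the loss factor
may also be applied to the masses that the two mass functions share. -/
lemma one_le_powerFactor {α : ℝ} (hα : 1 < α) : 1 ≤ powerFactor α := by
  simpa using rpow_chord_le hα one_pos one_pos

lemma powerFactor_le_one {α : ℝ} (hα0 : 0 < α) (hα : α < 1) : powerFactor α ≤ 1 := by
  simpa using le_rpow_chord hα0 hα one_pos one_pos

lemma log_two_div_exp_mul_log_two_nonneg : 0 ≤ Real.log (2 / (Real.exp 1 * Real.log 2)) := by
  simpa using mul_log_chord_le one_pos one_pos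

/-- Jensen's inequality for the mean over a finite set. -/
lemma convexOn_card_mul_le_sum {φ : ℝ → ℝ} (hφ : ConvexOn ℝ (Set.Ici 0) φ) {ι : Type*}
    {W : Finset ι} (hW : W.Nonempty) {a : ι → ℝ} (ha : ∀ i, 0 ≤ a i) :
    W.card * φ ((∑ i ∈ W, a i) / W.card) ≤ ∑ i ∈ W, φ (a i) := by
  have hW' : (0 : ℝ) < W.card := by exact_mod_cast Finset.card_pos.2 hW
  have h := hφ.map_sum_le (t := W) (w := fun _ => (W.card : ℝ)⁻¹) (p := a)
    (fun i _ => by positivity) (by simp [hW'.ne']) (fun i _ => ha i)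
  simp only [smul_eq_mul, ← Finset.mul_sum] at h
  rw [inv_mul_eq_div, inv_mul_eq_div, le_div_iff₀ hW'] at h
  linarith

/-! ### Entropy as a function of convex sums -/

lemma sum_rpow_pos {ι : Type*} [Fintype ι] {P : ι → ℝ} (hP : P ∈ stdSimplex ℝ ι) (α : ℝ) :
    0 < ∑ i, P i ^ α := by
  obtain ⟨i, -, hi⟩ : ∃ i ∈ Finset.univ, 0 < P i :=
    Finset.exists_lt_of_sum_lt (s := Finset.univ) (f := fun _ => (0 : ℝ)) (g := P)
      (by simp [hP.2])
  exact (Real.rpow_pos_of_pos hi α).trans_le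
    (Finset.single_le_sum (f := fun i => P i ^ α)
      (fun j _ => Real.rpow_nonneg (hP.1 j) α) (Finset.mem_univ i))

lemma renyiEntropy_one {ι : Type*} [Fintype ι] (b : ℝ) (P : ι → ℝ) :
    renyiEntropy b 1 P = -(∑ i, P i * Real.log (P i)) / Real.log b := by
  simp only [renyiEntropy, if_true, Real.logb, neg_div, Finset.sum_div, mul_div_assoc]

/-- The Rényi entropies decrease when all convex sums increase. -/
lemma renyiEntropy_le_of_convex_sum_le {ι κ : Type*} [Fintype ι] [Fintype κ] {b α : ℝ}
    (hb : 1 < b) (hα : 0 < α) {P : ι → ℝ} {Q : κ → ℝ} (hP : P ∈ stdSimplex ℝ ι)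
    (hQ : Q ∈ stdSimplex ℝ κ)
    (h : ∀ φ : ℝ → ℝ, ConvexOn ℝ (Set.Ici 0) φ → ∑ i, φ (P i) ≤ ∑ i, φ (Q i)) :
    renyiEntropy b α Q ≤ renyiEntropy b α P := by
  rcases lt_trichotomy α 1 with h1 | rfl | h1
  · have hle := h _ (Real.concaveOn_rpow hα.le h1.le).neg
    simp only [Pi.neg_apply, Finset.sum_neg_distrib, neg_le_neg_iff] at hle
    rw [renyiEntropy, renyiEntropy, if_neg h1.ne, if_neg h1.ne]
    exact mul_le_mul_of_nonneg_left (Real.logb_le_logb_of_le hb (sum_rpow_pos hQ α) hle)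
      (one_div_nonneg.2 (by linarith))
  · have hle := h _ Real.convexOn_mul_log
    rw [renyiEntropy_one, renyiEntropy_one]
    exact div_le_div_of_nonneg_right (neg_le_neg hle) (Real.log_pos hb).le
  · have hle := h _ (convexOn_rpow h1.le)
    rw [renyiEntropy, renyiEntropy, if_neg h1.ne', if_neg h1.ne']
    exact mul_le_mul_of_nonpos_left (Real.logb_le_logb_of_le hb (sum_rpow_pos hP α) hle)
      (one_div_nonpos.2 (by linarith))

/-- Two mass functions that agree up to equally many masses, those of the first with ratios
at most `2`: the entropy of the first is at least the one of the second minus `v(α)`. -/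
lemma renyiEntropy_sub_v_le {ι : Type*} [Fintype ι] [DecidableEq ι] {b α : ℝ} (hb : 1 < b)
    (hα : 0 < α) {Q X : ι → ℝ} (hQ : Q ∈ stdSimplex ℝ ι) (hX : X ∈ stdSimplex ℝ ι)
    {K W : Finset ι} {p : ℝ} (hK : K.Nonempty) (hKW : K.card = W.card) (hp : 0 ≤ p)
    (hKp : ∀ j ∈ K, p ≤ Q j ∧ Q j ≤ 2 * p)
    (heq : ∀ φ : ℝ → ℝ, ∑ j ∈ Kᶜ, φ (Q j) = ∑ i ∈ Wᶜ, φ (X i)) :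
    renyiEntropy b α X - v b α ≤ renyiEntropy b α Q := by
  have hW : W.Nonempty := Finset.card_pos.1 (hKW ▸ Finset.card_pos.2 hK)
  have hsum : ∑ j ∈ K, Q j = ∑ i ∈ W, X i := by
    have h1 := Finset.sum_add_sum_compl K Q
    have h2 := Finset.sum_add_sum_compl W X
    have h3 := heq id
    simp only [id] at h3
    rw [hQ.2] at h1
    rw [hX.2] at h2
    linarith
  rcases lt_trichotomy α 1 with h1 | rfl | h1
  · have hcore := le_sum_rpow hα h1 hK hp hKp
    -- X need not be constant on W: Jensen compares it with its mean there, which is also the mean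
    -- of Q on K.
    have hJ := convexOn_card_mul_le_sum (Real.concaveOn_rpow hα.le h1.le).neg hW hX.1
    simp only [Pi.neg_apply, Finset.sum_neg_distrib] at hJ
    rw [hsum, hKW] at hcore
    have hV := powerFactor_le_one hα h1
    have hV0 := powerFactor_pos hα h1.ne
    have h3 := heq fun x => x ^ α
    have h4 : 0 ≤ ∑ i ∈ Wᶜ, X i ^ α := Finset.sum_nonneg fun i _ => Real.rpow_nonneg (hX.1 i) α
    have h5 : powerFactor α * ∑ i, X i ^ α ≤ ∑ j, Q j ^ α := by
      rw [← Finset.sum_add_sum_compl K fun i => Q i ^ α,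
        ← Finset.sum_add_sum_compl W fun i => X i ^ α, h3,
        mul_add]
      have h6 : powerFactor α * ∑ i ∈ W, X i ^ α ≤
          powerFactor α * (W.card * ((∑ i ∈ W, X i) / W.card) ^ α) :=
        mul_le_mul_of_nonneg_left (by linarith) hV0.le
      nlinarith
    have h7 := Real.logb_le_logb_of_le hb (mul_pos hV0 (sum_rpow_pos hX α)) h5
    rw [Real.logb_mul hV0.ne' (sum_rpow_pos hX α).ne', logb_powerFactor b hα h1.ne] at h7
    have h8 := mul_le_mul_of_nonneg_left h7 (one_div_nonneg.2 (by linarith : 0 ≤ 1 - α))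
    rw [renyiEntropy, renyiEntropy, if_neg h1.ne, if_neg h1.ne]
    refine le_trans (le_of_eq ?_) h8
    have : 1 - α ≠ 0 := by linarith
    field_simp
    ring
  · have hcore := sum_mul_log_le hK hp hKp
    have hJ := convexOn_card_mul_le_sum Real.convexOn_mul_log hW hX.1
    rw [hsum, hKW] at hcore
    have h3 := heq fun x => x * Real.log x
    have hV := log_two_div_exp_mul_log_two_nonneg
    -- For α = 1 the loss is additive and weighted by the mass of W, so at most the full constant.
    have h4 : ∑ i ∈ W, X i ≤ 1 := by
      rw [← hX.2]
      exact Finset.sum_le_sum_of_subset_of_nonneg (Finset.subset_univ _) fun i _ _ => hX.1 i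
    have h5 : ∑ j, Q j * Real.log (Q j) ≤ ∑ i, X i * Real.log (X i) +
        Real.log (2 / (Real.exp 1 * Real.log 2)) := by
      rw [← Finset.sum_add_sum_compl K,
        ← Finset.sum_add_sum_compl W (fun i => X i * Real.log (X i)), h3]
      nlinarith
    rw [renyiEntropy_one, renyiEntropy_one, v, if_pos rfl, Real.logb, ← sub_div]
    exact div_le_div_of_nonneg_right (by linarith) (Real.log_pos hb).le
  · have hcore := sum_rpow_le h1 hK hp hKp
    have hJ := convexOn_card_mul_le_sum (convexOn_rpow h1.le) hW hX.1
    rw [hsum, hKW] at hcore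
    have hV := one_le_powerFactor h1
    have hV0 := powerFactor_pos hα h1.ne'
    have h3 := heq fun x => x ^ α
    have h4 : 0 ≤ ∑ i ∈ Wᶜ, X i ^ α := Finset.sum_nonneg fun i _ => Real.rpow_nonneg (hX.1 i) α
    have h5 : ∑ j, Q j ^ α ≤ powerFactor α * ∑ i, X i ^ α := by
      rw [← Finset.sum_add_sum_compl K fun i => Q i ^ α,
        ← Finset.sum_add_sum_compl W fun i => X i ^ α, h3,
        mul_add]
      have h6 : powerFactor α * (W.card * ((∑ i ∈ W, X i) / W.card) ^ α) ≤
          powerFactor α * ∑ i ∈ W, X i ^ α :=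
        mul_le_mul_of_nonneg_left (by linarith) hV0.le
      nlinarith
    have h7 := Real.logb_le_logb_of_le hb (sum_rpow_pos hQ α) h5
    rw [Real.logb_mul hV0.ne' (sum_rpow_pos hX α).ne', logb_powerFactor b hα h1.ne'] at h7
    have h8 := mul_le_mul_of_nonpos_left h7 (one_div_nonpos.2 (by linarith : 1 - α ≤ 0))
    rw [renyiEntropy, renyiEntropy, if_neg h1.ne', if_neg h1.ne']
    refine le_trans (le_of_eq ?_) h8
    have : 1 - α ≠ 0 := by linarith
    field_simp
    ring

/-! ### The limit of the entropy gaps -/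

lemma continuousOn_renyiEntropy {ι : Type*} [Fintype ι] (b : ℝ) {α : ℝ} (hα : 0 < α) :
    ContinuousOn (renyiEntropy b α) (stdSimplex ℝ ι) := by
  by_cases h : α = 1
  · subst h
    have : (renyiEntropy b 1 : (ι → ℝ) → ℝ) =
        fun P => -(∑ i, P i * Real.log (P i)) / Real.log b := funext (renyiEntropy_one b)
    rw [this]
    refine Continuous.continuousOn (Continuous.div_const (Continuous.neg ?_) _)
    exact continuous_finsetSum _ fun i _ => Real.continuous_mul_log.comp (continuous_apply i)
  · have : (renyiEntropy b α : (ι → ℝ) → ℝ) =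
        fun P => 1 / (1 - α) * (Real.log (∑ i, P i ^ α) / Real.log b) := by
      funext P; rw [renyiEntropy, if_neg h, Real.logb]
    rw [this]
    refine continuousOn_const.mul (ContinuousOn.div_const (ContinuousOn.log ?_ ?_) _)
    · exact (continuous_finsetSum _ fun i _ =>
        (continuous_apply i).rpow_const fun _ => Or.inr hα.le).continuousOn
    · exact fun P hP => (sum_rpow_pos hP α).ne'

lemma boundedRatio_subset_stdSimplex (k : ℕ) (ρ : ℝ) :
    boundedRatio k ρ ⊆ stdSimplex ℝ (Fin k) := fun _ h => h.1

lemma isCompact_boundedRatio (k : ℕ) (ρ : ℝ) : IsCompact (boundedRatio k ρ) := by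
  have h : boundedRatio k ρ = stdSimplex ℝ (Fin k) ∩ ⋂ i, ⋂ j, {P | P i ≤ ρ * P j} := by
    ext P; simp [boundedRatio]
  rw [h]
  refine (isCompact_stdSimplex ℝ (Fin k)).inter_right ?_
  exact isClosed_iInter fun i => isClosed_iInter fun j =>
    isClosed_le (continuous_apply i) (continuous_const.mul (continuous_apply j))

/-- The mass function on `k` points with `j` masses that are twice the other ones. -/
noncomputable def twoLevel (k j : ℕ) (i : Fin k) : ℝ :=
  if (i : ℕ) < j then 2 * (1 / ((k : ℝ) + j)) else 1 / ((k : ℝ) + j)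

lemma sum_twoLevel {k j : ℕ} (hj : j ≤ k) (φ : ℝ → ℝ) :
    ∑ i, φ (twoLevel k j i) =
      j * φ (2 * (1 / ((k : ℝ) + j))) + (k - j) * φ (1 / ((k : ℝ) + j)) := by
  have hcard : (Finset.univ.filter (fun i : Fin k => (i : ℕ) < j)).card = j := by
    rw [Fin.card_filter_val_lt, min_eq_right hj]
  simp only [twoLevel, apply_ite φ]
  rw [Finset.sum_ite, Finset.sum_const, Finset.sum_const, Finset.filter_not,
    Finset.card_sdiff_of_subset (Finset.subset_univ _), hcard, Finset.card_univ, Fintype.card_fin,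
    nsmul_eq_mul, nsmul_eq_mul, Nat.cast_sub hj]

lemma twoLevel_mem_boundedRatio {k j : ℕ} (hk : 0 < k) (hj : j ≤ k) :
    twoLevel k j ∈ boundedRatio k 2 := by
  have hk' : (0 : ℝ) < k := by exact_mod_cast hk
  have ht : 0 < 1 / ((k : ℝ) + j) := by positivity
  refine ⟨⟨fun i => ?_, ?_⟩, fun i l => ?_⟩
  · rw [twoLevel]; split_ifs <;> positivity
  · have := sum_twoLevel hj id
    simp only [id] at this
    rw [this]
    have : (k : ℝ) + j ≠ 0 := by positivity
    field_simp
    ring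
  · simp only [twoLevel]; split_ifs <;> linarith

/-- The limiting entropy gap of two-level mass functions in which the fraction `x` of the masses
is doubled. -/
noncomputable def twoLevelGap (b α x : ℝ) : ℝ :=
  if α = 1 then 2 * x / (1 + x) * Real.logb b 2 - Real.logb b (1 + x)
  else 1 / (α - 1) * (Real.logb b (1 + x * ((2 : ℝ) ^ α - 1)) - α * Real.logb b (1 + x))

/-- An exact identity for every k: the gap depends on j and k only through j / k, so the passage to
the limit needs only continuity in the fraction. -/
lemma logb_sub_renyiEntropy_twoLevel (b : ℝ) {α : ℝ} (hα : 0 < α) {k j : ℕ} (hk : 0 < k)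
    (hj : j ≤ k) :
    Real.logb b k - renyiEntropy b α (twoLevel k j) = twoLevelGap b α ((j : ℝ) / k) := by
  have hk' : (0 : ℝ) < k := by exact_mod_cast hk
  have hkj : (0 : ℝ) < k + j := by positivity
  have h1 : (1 : ℝ) + j / k = (k + j) / k := by field_simp
  by_cases h : α = 1
  · subst h
    rw [twoLevelGap, if_pos rfl, renyiEntropy, if_pos rfl,
      sum_twoLevel hj (fun x => x * Real.logb b x), h1,
      Real.logb_mul (by norm_num) (by positivity), Real.logb_div hkj.ne' hk'.ne',
      one_div, Real.logb_inv]
    field_simp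
    ring
  · have hA := two_rpow_sub_one_pos hα
    have h2 : (1 : ℝ) + j / k * ((2 : ℝ) ^ α - 1) = (k + j * ((2 : ℝ) ^ α - 1)) / k := by
      field_simp
    have h3 : (j : ℝ) * (2 * (1 / ((k : ℝ) + j))) ^ α + (k - j) * (1 / ((k : ℝ) + j)) ^ α
        = (k + j * ((2 : ℝ) ^ α - 1)) / ((k : ℝ) + j) ^ α := by
      rw [Real.mul_rpow (by norm_num) (by positivity), Real.div_rpow (by norm_num) hkj.le,
        Real.one_rpow]
      ring
    have h4 : α - 1 ≠ 0 := sub_ne_zero.2 h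
    have h4' : 1 - α ≠ 0 := sub_ne_zero.2 (Ne.symm h)
    rw [twoLevelGap, if_neg h, renyiEntropy, if_neg h, sum_twoLevel hj (fun x => x ^ α), h1, h2,
      h3, Real.logb_div (by positivity) hk'.ne', Real.logb_div hkj.ne' hk'.ne',
      Real.logb_div (by positivity) (by positivity), Real.logb_rpow_eq_mul_logb_of_pos hkj]
    field_simp
    ring

lemma continuousAt_twoLevelGap (b : ℝ) {α x : ℝ} (hα : 0 < α) (hx : 0 ≤ x) :
    ContinuousAt (twoLevelGap b α) x := by
  have hA := two_rpow_sub_one_pos hα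
  have h1 : (1 : ℝ) + x ≠ 0 := by positivity
  have h2 : (1 : ℝ) + x * ((2 : ℝ) ^ α - 1) ≠ 0 := by positivity
  by_cases h : α = 1
  · have : twoLevelGap b α = fun x =>
        2 * x / (1 + x) * Real.logb b 2 - Real.log (1 + x) / Real.log b := by
      funext x; rw [twoLevelGap, if_pos h]; rfl
    rw [this]
    refine ContinuousAt.sub (ContinuousAt.mul (ContinuousAt.div (by fun_prop) (by fun_prop) h1)
      continuousAt_const) (ContinuousAt.div_const (ContinuousAt.log (by fun_prop) h1) _)
  · have : twoLevelGap b α = fun x => 1 / (α - 1) *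
        (Real.log (1 + x * ((2 : ℝ) ^ α - 1)) / Real.log b
          - α * (Real.log (1 + x) / Real.log b)) := by
      funext x; rw [twoLevelGap, if_neg h]; rfl
    rw [this]
    have h3 : ContinuousAt (fun x : ℝ => Real.log (1 + x * ((2 : ℝ) ^ α - 1))) x :=
      ContinuousAt.log (by fun_prop) h2
    have h4 : ContinuousAt (fun x : ℝ => Real.log (1 + x)) x := ContinuousAt.log (by fun_prop) h1
    exact continuousAt_const.mul ((h3.div_const _).sub (continuousAt_const.mul (h4.div_const _)))

/-- From exp y ≥ 1 + y with y = (1 - α) log 2, using log 2 ≤ 1 and 1 - α < 0. It keeps the extremal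
fraction at most 1. -/
lemma two_sub_le_two_rpow_one_sub {α : ℝ} (hα : 1 < α) : 2 - α ≤ (2 : ℝ) ^ (1 - α) := by
  have h2 : Real.log 2 ≤ 1 := by
    have := Real.log_le_sub_one_of_pos (x := 2) (by norm_num)
    linarith
  have h := Real.add_one_le_exp (Real.log 2 * (1 - α))
  rw [Real.rpow_def_of_pos (by norm_num)]
  nlinarith

/-- The gap `v(α)` is the one of two-level mass functions with a suitable fraction of doubled
masses. -/
lemma exists_twoLevelGap_eq_v (b : ℝ) {α : ℝ} (hα : 0 < α) :
    ∃ x, 0 ≤ x ∧ x ≤ 1 ∧ twoLevelGap b α x = v b α := by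
  by_cases h : α = 1
  · subst h
    have h1 := Real.log_two_gt_d9
    have h2 := Real.log_two_lt_d9
    have h3 : 0 < Real.log 2 := by linarith
    -- The mean is 1 + x times the smaller mass, and 1 + x = 2 log 2 is the equality case of
    -- `mul_log_chord_le`.
    refine ⟨2 * Real.log 2 - 1, by linarith, by linarith, ?_⟩
    rw [twoLevelGap, if_pos rfl, v, if_pos rfl, add_sub_cancel]
    simp only [Real.logb]
    rw [log_two_div_exp_mul_log_two, Real.log_mul (by norm_num) h3.ne']
    have : 2 * (2 * Real.log 2 - 1) / (2 * Real.log 2) * (Real.log 2 / Real.log b) =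
        (2 * Real.log 2 - 1) / Real.log b := by field_simp
    rw [this, ← sub_div]
    congr 1
    ring
  · have hA := two_rpow_sub_one_pos hα
    have hC := sub_one_div_two_rpow_sub_two_pos h
    have h4 : α - 1 ≠ 0 := sub_ne_zero.2 h
    have hB2 : (2 : ℝ) ^ α - 2 ≠ 0 := by
      intro h
      rw [h, div_zero] at hC
      exact lt_irrefl _ hC
    have hx1 : 1 + (α / ((2 : ℝ) ^ α - 1) / ((α - 1) / ((2 : ℝ) ^ α - 2)) - 1)
        = α / ((2 : ℝ) ^ α - 1) / ((α - 1) / ((2 : ℝ) ^ α - 2)) := by ring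
    have hx2 : 1 + (α / ((2 : ℝ) ^ α - 1) / ((α - 1) / ((2 : ℝ) ^ α - 2)) - 1) *
        ((2 : ℝ) ^ α - 1) = ((α - 1) / ((2 : ℝ) ^ α - 2))⁻¹ := by
      field_simp
      ring
    have hmul : (2 : ℝ) ^ (1 - α) * (2 : ℝ) ^ α = 2 := by
      rw [← Real.rpow_add (by norm_num)]; simp
    have hpow : 0 < (2 : ℝ) ^ α := Real.rpow_pos_of_pos (by norm_num) _
    -- Here 1 + x is the ratio c / q at which u = w in `rpow_chord_eq`. For α > 1, x ≥ 0 amounts to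
    -- 1 + α ≤ 2 ^ α and x ≤ 1 to 2 - α ≤ 2 ^ (1 - α); for α < 1 both inequalities are reversed.
    refine ⟨α / ((2 : ℝ) ^ α - 1) / ((α - 1) / ((2 : ℝ) ^ α - 2)) - 1, ?_, ?_, ?_⟩
    · rw [sub_nonneg, le_div_iff₀ hC, one_mul, le_div_iff₀ hA]
      rcases lt_or_gt_of_ne h with h1 | h1
      · have h5 := rpow_one_add_le_one_add_mul_self (s := 1) (by norm_num) hα.le h1.le
        norm_num at h5
        rw [div_mul_eq_mul_div, div_le_iff_of_neg (by linarith)]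
        linarith
      · have h5 := one_add_mul_self_le_rpow_one_add (s := 1) (by norm_num) h1.le
        norm_num at h5
        rw [div_mul_eq_mul_div, div_le_iff₀ (by linarith)]
        linarith
    · rw [sub_le_iff_le_add, div_le_iff₀ hC, div_le_iff₀ hA]
      rcases lt_or_gt_of_ne h with h1 | h1
      · have h5 := rpow_one_add_le_one_add_mul_self (s := 1) (by norm_num) hα.le h1.le
        have h6 := rpow_one_add_le_one_add_mul_self (s := 1) (p := 1 - α) (by norm_num)
          (by linarith) (by linarith)
        norm_num at h5 h6
        rw [mul_div_assoc', div_mul_eq_mul_div, le_div_iff_of_neg (by linarith)]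
        nlinarith
      · have h5 := one_add_mul_self_le_rpow_one_add (s := 1) (by norm_num) h1.le
        have h6 := two_sub_le_two_rpow_one_sub h1
        norm_num at h5
        rw [mul_div_assoc', div_mul_eq_mul_div, le_div_iff₀ (by linarith)]
        nlinarith
    · rw [twoLevelGap, if_neg h, hx1, hx2, v, if_neg h, Real.logb_inv,
        Real.logb_div (div_pos hα hA).ne' hC.ne']
      field_simp
      ring

lemma renyiEntropy_uniform (b : ℝ) (α : ℝ) {k : ℕ} (hk : 0 < k) :
    renyiEntropy b α (fun _ : Fin k => 1 / (k : ℝ)) = Real.logb b k := by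
  have hk' : (0 : ℝ) < k := by exact_mod_cast hk
  rw [renyiEntropy]
  split_ifs with h
  · simp [hk'.ne']
  · have h4' : 1 - α ≠ 0 := sub_ne_zero.2 (Ne.symm h)
    rw [Finset.sum_const, Finset.card_univ, Fintype.card_fin, nsmul_eq_mul,
      Real.logb_mul hk'.ne' (by positivity), Real.logb_rpow_eq_mul_logb_of_pos (by positivity),
      one_div (k : ℝ), Real.logb_inv]
    field_simp
    ring

lemma uniform_mem_stdSimplex {k : ℕ} (hk : 0 < k) :
    (fun _ : Fin k => 1 / (k : ℝ)) ∈ stdSimplex ℝ (Fin k) := by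
  have hk' : (0 : ℝ) < k := by exact_mod_cast hk
  exact ⟨fun _ => by positivity, by simp [hk'.ne']⟩

/-- The extreme case of `renyiEntropy_sub_v_le` in which no masses are set aside and the comparison
is with the uniform distribution. -/
lemma logb_sub_renyiEntropy_le_v {b α : ℝ} (hb : 1 < b) (hα : 0 < α) {k : ℕ} (hk : 0 < k)
    {P : Fin k → ℝ} (hP : P ∈ boundedRatio k 2) :
    Real.logb b k - renyiEntropy b α P ≤ v b α := by
  have : Nonempty (Fin k) := ⟨⟨0, hk⟩⟩
  obtain ⟨i, hi⟩ := Finite.exists_min P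
  have h := renyiEntropy_sub_v_le (K := Finset.univ) (W := Finset.univ) (p := P i) hb hα hP.1
    (uniform_mem_stdSimplex hk) Finset.univ_nonempty rfl (hP.1.1 i)
    (fun j _ => ⟨hi j, hP.2 j i⟩) (by simp)
  rw [renyiEntropy_uniform b α hk] at h
  linarith

lemma exists_min_renyiEntropy {b α : ℝ} (hα : 0 < α) {k : ℕ} (hk : 0 < k) :
    ∃ P ∈ boundedRatio k 2, ∀ Q ∈ boundedRatio k 2, renyiEntropy b α P ≤ renyiEntropy b α Q :=
  (isCompact_boundedRatio k 2).exists_isMinOn ⟨_, twoLevel_mem_boundedRatio hk (Nat.zero_le k)⟩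
    ((continuousOn_renyiEntropy b hα).mono (boundedRatio_subset_stdSimplex k 2))

/-- `v(α)` is the limit of the entropy gaps. -/
lemma tendsto_renyiGap {b α : ℝ} (hb : 1 < b) (hα : 0 < α) :
    Tendsto (fun k : ℕ => renyiGap b α k 2) atTop (𝓝 (v b α)) := by
  obtain ⟨x, hx0, hx1, hxv⟩ := exists_twoLevelGap_eq_v b hα
  -- Doubling ⌊x k⌋ of the k masses approximates the extremal fraction x.
  have hlow : Tendsto (fun k : ℕ => twoLevelGap b α ((⌊x * (k : ℝ)⌋₊ : ℝ) / k)) atTop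
      (𝓝 (v b α)) := by
    rw [← hxv]
    exact (continuousAt_twoLevelGap b hα hx0).tendsto.comp
      ((tendsto_nat_floor_mul_div_atTop hx0).comp tendsto_natCast_atTop_atTop)
  have hgap : ∀ k : ℕ, 0 < k → ∃ P ∈ boundedRatio k 2,
      renyiGap b α k 2 = Real.logb b k - renyiEntropy b α P ∧
      ∀ Q ∈ boundedRatio k 2, renyiEntropy b α P ≤ renyiEntropy b α Q := by
    intro k hk
    obtain ⟨P, hP, hmin⟩ := exists_min_renyiEntropy (b := b) hα hk
    refine ⟨P, hP, ?_, hmin⟩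
    have : IsLeast (renyiEntropy b α '' boundedRatio k 2) (renyiEntropy b α P) :=
      ⟨⟨P, hP, rfl⟩, by rintro _ ⟨Q, hQ, rfl⟩; exact hmin Q hQ⟩
    rw [renyiGap, this.csInf_eq]
  refine tendsto_of_tendsto_of_tendsto_of_le_of_le' hlow tendsto_const_nhds ?_ ?_
  · filter_upwards [eventually_gt_atTop 0] with k hk
    obtain ⟨P, -, hgapP, hmin⟩ := hgap k hk
    have hj : ⌊x * (k : ℝ)⌋₊ ≤ k :=
      Nat.floor_le_of_le (mul_le_of_le_one_left (Nat.cast_nonneg k) hx1)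
    rw [hgapP, ← logb_sub_renyiEntropy_twoLevel b hα hk hj]
    linarith [hmin _ (twoLevel_mem_boundedRatio hk hj)]
  · filter_upwards [eventually_gt_atTop 0] with k hk
    obtain ⟨P, hP, hgapP, -⟩ := hgap k hk
    rw [hgapP]
    exact logb_sub_renyiEntropy_le_v hb hα hk hP

/-- Only log (log 2) is delicate: log 2 = 1 - x with x ≈ 0.30685 bracketed by decimal bounds, and 14
terms of the series of log (1 - x) leave an error well below 10⁻⁶. -/
lemma abs_v_two_one_sub_le : |v 2 1 - 0.08607| ≤ 0.000005 := by
  have h1 := Real.log_two_gt_d9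
  have h2 := Real.log_two_lt_d9
  have h3 : 0 < Real.log 2 := by linarith
  have hll : |Real.log (Real.log 2) + 0.3665129| ≤ 0.000001 := by
    have hlo : Real.log (1 - 0.3068528197) ≤ Real.log (Real.log 2) :=
      Real.log_le_log (by norm_num) (by linarith)
    have hhi : Real.log (Real.log 2) ≤ Real.log (1 - 0.3068528191) :=
      Real.log_le_log h3 (by linarith)
    have e1 := Real.abs_log_sub_add_sum_range_le (x := 0.3068528197)
      (by rw [abs_of_pos] <;> norm_num) 14
    have e2 := Real.abs_log_sub_add_sum_range_le (x := 0.3068528191)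
      (by rw [abs_of_pos] <;> norm_num) 14
    rw [abs_le] at e1 e2
    have e1' := e1.1
    have e2' := e2.2
    norm_num [Finset.sum_range_succ, abs_of_pos] at e1' e2'
    norm_num at hlo hhi
    rw [abs_le]
    constructor <;> norm_num <;> linarith
  rw [v, if_pos rfl, Real.logb, log_two_div_exp_mul_log_two]
  rw [abs_le] at hll ⊢
  obtain ⟨h4, h5⟩ := hll
  constructor
  · rw [le_sub_iff_add_le, le_div_iff₀ h3]
    norm_num at h1 h2 h4 h5 ⊢
    linarith
  · rw [sub_le_iff_le_add, div_le_iff₀ h3]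
    norm_num at h1 h2 h4 h5 ⊢
    linarith

/-! ### From random variables to mass functions, and the theorem -/

section law

variable {Ω : Type*} [MeasurableSpace Ω] (μ : Measure Ω) [IsProbabilityMeasure μ] {n m : ℕ}
  {X : Ω → Fin n}

lemma pmfOf_mem_stdSimplex (hX : Measurable X) : pmfOf μ X ∈ stdSimplex ℝ (Fin n) := by
  refine ⟨fun i => measureReal_nonneg, ?_⟩
  simp only [pmfOf]
  rw [sum_measureReal_preimage_singleton _ fun i _ => hX (measurableSet_singleton i)]
  simp

lemma pmfOf_comp (hX : Measurable X) (f : Fin n → Fin m) :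
    pmfOf μ (f ∘ X) = push (pmfOf μ X) f := by
  funext j
  simp only [pmfOf, push]
  rw [sum_measureReal_preimage_singleton _ fun i _ => hX (measurableSet_singleton i)]
  congr 1
  ext ω
  simp

end law

lemma push_mem_stdSimplex {n m : ℕ} {P : Fin n → ℝ} (hP : P ∈ stdSimplex ℝ (Fin n))
    (f : Fin n → Fin m) : push P f ∈ stdSimplex ℝ (Fin m) :=
  ⟨push_nonneg hP.1 f, by rw [sum_push, hP.2]⟩

end RenyiMerging

theorem theorem2 {Ω : Type*} [MeasurableSpace Ω] (μ : Measure Ω) [IsProbabilityMeasure μ]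
    (b : ℝ) (hb : 1 < b) (n m : ℕ) (hm : 2 ≤ m) (hmn : m < n)
    (X : Ω → Fin n) (hX : Measurable X) (hsorted : Antitone (RenyiMerging.pmfOf μ X)) :
    -- `v(α)` is the limit `c_α^{(∞)}(2)` of `c_α^{(k)}(2)`, in whose definition the minimum exists
    (∀ α : ℝ, 0 < α →
      (∀ k : ℕ, 2 ≤ k →
        ∃ P ∈ RenyiMerging.boundedRatio k 2, ∀ Q ∈ RenyiMerging.boundedRatio k 2,
          RenyiMerging.renyiEntropy b α P ≤ RenyiMerging.renyiEntropy b α Q) ∧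
      Tendsto (fun k : ℕ => RenyiMerging.renyiGap b α k 2) atTop (𝓝 (RenyiMerging.v b α))) ∧
    -- `v(1) ≈ 0.08607` bits
    |RenyiMerging.v 2 1 - 0.08607| ≤ 0.000005 ∧
    -- the two explicit mass functions are probability mass functions on `m` points
    RenyiMerging.xTilde (RenyiMerging.pmfOf μ X) m ∈ stdSimplex ℝ (Fin m) ∧
    RenyiMerging.yTilde (RenyiMerging.pmfOf μ X) m ∈ stdSimplex ℝ (Fin m) ∧
    -- a) the maximum, over all maps as well as over the maps onto `{1, …, m}`
    (∀ α : ℝ, 0 < α →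
      ∀ F ∈ ({Set.univ, {f | Function.Surjective f}} : Set (Set (Fin n → Fin m))),
      ∃ M : ℝ, IsGreatest ((fun f : Fin n → Fin m =>
          RenyiMerging.renyiEntropy b α (RenyiMerging.pmfOf μ (f ∘ X))) '' F) M ∧
        M ∈ Set.Icc
          (RenyiMerging.renyiEntropy b α (RenyiMerging.xTilde (RenyiMerging.pmfOf μ X) m)
            - RenyiMerging.v b α)
          (RenyiMerging.renyiEntropy b α (RenyiMerging.xTilde (RenyiMerging.pmfOf μ X) m))) ∧
    -- b) the Huffman construction exists, and its result attains the bounds for all `α` at once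
    ((∃ f : Fin n → Fin m, Function.Surjective f ∧ RenyiMerging.IsHuffmanMap (RenyiMerging.pmfOf μ X) f) ∧
      ∀ f : Fin n → Fin m, RenyiMerging.IsHuffmanMap (RenyiMerging.pmfOf μ X) f →
        ∀ α : ℝ, 0 < α →
          RenyiMerging.renyiEntropy b α (RenyiMerging.pmfOf μ (f ∘ X)) ∈ Set.Icc
            (RenyiMerging.renyiEntropy b α (RenyiMerging.xTilde (RenyiMerging.pmfOf μ X) m)
              - RenyiMerging.v b α)
            (RenyiMerging.renyiEntropy b α
              (RenyiMerging.xTilde (RenyiMerging.pmfOf μ X) m))) ∧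
    -- c) the minimum over the maps onto `{1, …, m}`
    (∀ α : ℝ, 0 < α →
      IsLeast ((fun f : Fin n → Fin m =>
          RenyiMerging.renyiEntropy b α (RenyiMerging.pmfOf μ (f ∘ X))) ''
            {f | Function.Surjective f})
        (RenyiMerging.renyiEntropy b α
          (RenyiMerging.yTilde (RenyiMerging.pmfOf μ X) m))) := by
  have hP := RenyiMerging.pmfOf_mem_stdSimplex μ hX
  have hcomp : ∀ f : Fin n → Fin m, RenyiMerging.pmfOf μ (f ∘ X) =
      RenyiMerging.push (RenyiMerging.pmfOf μ X) f := RenyiMerging.pmfOf_comp μ hX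
  simp only [hcomp]
  generalize RenyiMerging.pmfOf μ X = P at hP hsorted
  obtain ⟨hXt, hXle⟩ :=
    RenyiMerging.xTilde_mem_stdSimplex_and_sum_le hP.1 hP.2 hsorted hm hmn
  have hYt : RenyiMerging.yTilde P m ∈ stdSimplex ℝ (Fin m) := by
    rw [RenyiMerging.yTilde_eq_push P hm hmn]
    exact RenyiMerging.push_mem_stdSimplex hP _
  have hupper : ∀ α : ℝ, 0 < α → ∀ f : Fin n → Fin m,
      RenyiMerging.renyiEntropy b α (RenyiMerging.push P f)
        ≤ RenyiMerging.renyiEntropy b α (RenyiMerging.xTilde P m) := fun α hα f =>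
    RenyiMerging.renyiEntropy_le_of_convex_sum_le hb hα hXt
      (RenyiMerging.push_mem_stdSimplex hP f) fun φ hφ => hXle φ hφ f
  have hlower : ∀ f : Fin n → Fin m, RenyiMerging.IsHuffmanMap P f → ∀ α : ℝ, 0 < α →
      RenyiMerging.renyiEntropy b α (RenyiMerging.xTilde P m) - RenyiMerging.v b α
        ≤ RenyiMerging.renyiEntropy b α (RenyiMerging.push P f) := by
    intro f hf α hα
    obtain ⟨K, W, p, hK, hKW, hp, hKp, heq⟩ := hf.exists_levels hP.1 hP.2 hsorted hm hmn
    exact RenyiMerging.renyiEntropy_sub_v_le hb hα (RenyiMerging.push_mem_stdSimplex hP f) hXt hK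
      hKW hp hKp heq
  obtain ⟨g, hg⟩ := RenyiMerging.exists_isHuffmanMap hP.1 hm hmn
  have hgs := hg.surjective hP.1
  refine ⟨fun α hα => ⟨fun k hk => RenyiMerging.exists_min_renyiEntropy hα (by omega),
    RenyiMerging.tendsto_renyiGap hb hα⟩, RenyiMerging.abs_v_two_one_sub_le, hXt, hYt, ?_,
    ⟨⟨g, hgs, hg⟩, fun f hf α hα => ⟨hlower f hf α hα, hupper α hα f⟩⟩, ?_⟩
  · intro α hα F hF
    -- The Huffman map is onto, so it witnesses the lower bound for both families of maps.
    have hgF : g ∈ F := by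
      rcases hF with rfl | rfl
      · trivial
      · exact hgs
    obtain ⟨f, hf, hmax⟩ := Set.exists_max_image F
      (fun f => RenyiMerging.renyiEntropy b α (RenyiMerging.push P f)) F.toFinite ⟨g, hgF⟩
    refine ⟨_, ⟨⟨f, hf, rfl⟩, ?_⟩, (hlower g hg α hα).trans (hmax g hgF), hupper α hα f⟩
    rintro _ ⟨f', hf', rfl⟩
    exact hmax f' hf'
  · intro α hα
    refine ⟨⟨RenyiMerging.collectFirst hm, RenyiMerging.collectFirst_surjective hm hmn, ?_⟩, ?_⟩
    · simp only [RenyiMerging.yTilde_eq_push P hm hmn]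
    · rintro _ ⟨f, hf, rfl⟩
      exact RenyiMerging.renyiEntropy_le_of_convex_sum_le hb hα
        (RenyiMerging.push_mem_stdSimplex hP f) hYt fun φ hφ =>
          RenyiMerging.sum_push_le_sum_yTilde hP.1 hsorted hm hmn hφ hf
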